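/- Let $X,Y$ be real or complex Hilbert spaces and let $T:X\to Y$ be a bounded linear operator with $\ker T=\{0\}$ and $\ker T^*=\{0\}$. Let $F_\lambda$ be the spectral family of $TT^*$. Let $\mu>0$ and $\gamma\in[0,1/2]$ with $\mu+\gamma\le 1$, and put $\kappa(t)=t^\gamma$. Let $x\in\operatorname{Ran}((T^*T)^\mu)$, $f\in\operatorname{Ran}((T^*T)^\gamma)$ and $y=Tx\neq 0$. For $\delta\in(0,\delta_0)$, where $\delta_0>0$, let $y^\delta\in Y$ be noisy data with $\|y^\delta-y\|\le\delta$, and assume the noise condition: there is a constant $c$, independent of $\delta$ and $\alpha$, such that for all $\delta\in(0,\delta_0)$ and all $\alpha>0$ $$\alpha^2\int_\alpha^\infty \lambda^{-1}\kappa(\lambda)^2\,d\|F_\lambda(y^\delta-y)\|^2\le c\int_0^\alpha\lambda\,\kappa(\lambda)^2\,d\|F_\lambda(y^\delta-y)\|^2 .$$ Let $g_\alpha(\lambda)=\frac1{\alpha+\lambda}$ (Tikhonov regularization), $x_\alpha^\delta=g_\alpha(T^*T)T^*y^\delta$, and $$\psi(\alpha,y^\delta)=\|(I-T^*Tg_\alpha(T^*T))x_\alpha^\delta\|,\qquad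 \psi_\kappa(\alpha,y^\delta)=\|\kappa(T^*T)(I-T^*Tg_\alpha(T^*T))x_\alpha^\delta\| .$$ Fix $\alpha_{\max}>0$ (for example $\alpha_{\max}=\|T\|$). Let $\alpha(y^\delta)$ and $\alpha_\kappa(y^\delta)$ denote any minimizers over $\alpha\in(0,\alpha_{\max}]$ of $\psi(\cdot,y^\delta)$ and of $\psi_\kappa(\cdot,y^\delta)$, respectively, for those $\delta$ for which such minimizers exist. Then, as $\delta\to0$, $$\|x^\delta_{\alpha(y^\delta)}-x\|=O\left(\delta^{\frac{2\mu}{2\mu+1}\mu}\right),\qquad |\langle f,x^\delta_{\alpha(y^\delta)}-x\rangle|=O\left(\delta^{\frac{2\mu}{2\mu+1}(\mu+\gamma)}\right),\qquad |\langle f,x^\delta_{\alpha_\kappa(y^\delta)}-x\rangle|=O\left(\delta^{\frac{2(\mu+\gamma)^2}{2\mu+1}}\right),$$ where the implied constants do not depend on $\delta$ or on the choice of the minimizers. -/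

import Mathlib

namespace HilbertCalculus

section Calculus

variable {𝕜 H : Type*} [RCLike 𝕜] [NormedAddCommGroup H] [InnerProductSpace 𝕜 H]

/-- Bounded operators on a real or complex Hilbert space form a real algebra. -/
noncomputable instance (priority := low) realAlgebra : Algebra ℝ (H →L[𝕜] H) :=
  Algebra.restrictScalars ℝ 𝕜 (H →L[𝕜] H)

lemma real_algebraMap (r : ℝ) :
    algebraMap ℝ (H →L[𝕜] H) r = algebraMap 𝕜 (H →L[𝕜] H) (algebraMap ℝ 𝕜 r) := rfl

instance realScalarTower : IsScalarTower ℝ 𝕜 (H →L[𝕜] H) :=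
  IsScalarTower.of_algebraMap_eq fun _ => rfl

instance realBoundedSMul : IsBoundedSMul ℝ (H →L[𝕜] H) where
  dist_smul_pair' r a b := by
    have h : ∀ b : H →L[𝕜] H, r • b = (r : 𝕜) • b := fun _ => rfl
    have h0 : dist r 0 = ‖(r : 𝕜)‖ := by simp
    rw [h, h, h0, dist_eq_norm, dist_eq_norm, ← smul_sub, norm_smul]
  dist_pair_smul' r s a := by
    have h : ∀ t : ℝ, t • a = (t : 𝕜) • a := fun _ => rfl
    have h0 : dist r s = ‖(r : 𝕜) - (s : 𝕜)‖ := by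
      rw [← RCLike.ofReal_sub, RCLike.norm_ofReal, Real.dist_eq]
    have h1 : dist a (0 : H →L[𝕜] H) = ‖a‖ := dist_zero_right a
    rw [h, h, h0, h1, dist_eq_norm, ← sub_smul, norm_smul]

lemma real_smul_apply (r : ℝ) (a : H →L[𝕜] H) (v : H) : (r • a) v = (r : 𝕜) • a v := rfl

lemma spectrum_real_eq (a : H →L[𝕜] H) :
    spectrum ℝ a = (algebraMap ℝ 𝕜) ⁻¹' spectrum 𝕜 a := rfl

variable [CompleteSpace H]

instance realStarModule : StarModule ℝ (H →L[𝕜] H) where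
  star_smul r a := by
    have h : ∀ b : H →L[𝕜] H, r • b = (r : 𝕜) • b := fun _ => rfl
    rw [h a, star_smul, star_trivial r, h (star a), RCLike.star_def, RCLike.conj_ofReal]

/-- The real spectrum of a bounded operator is compact. -/
instance compactSpace_spectrum (a : H →L[𝕜] H) : CompactSpace (spectrum ℝ a) := by
  rw [← isCompact_iff_compactSpace, spectrum_real_eq]
  have h : Topology.IsClosedEmbedding (algebraMap ℝ 𝕜) :=
    (RCLike.ofRealLI (K := 𝕜)).isometry.isClosedEmbedding
  exact h.isCompact_preimage (spectrum.isCompact a)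

lemma abs_le_of_mem_spectrum {a : H →L[𝕜] H} {r : ℝ} (hr : r ∈ spectrum ℝ a) : |r| ≤ ‖a‖ := by
  rcases subsingleton_or_nontrivial H with hH | hH
  · rw [spectrum.of_subsingleton] at hr
    exact absurd hr (Set.notMem_empty r)
  rw [spectrum_real_eq] at hr
  simpa using spectrum.norm_le_norm_of_mem hr

lemma norm_mem_spectrum [Nontrivial H] {a : H →L[𝕜] H} (ha : IsSelfAdjoint a) :
    ‖a‖ ∈ spectrum ℝ a ∨ -‖a‖ ∈ spectrum ℝ a := by
  by_contra! h
  have h1 : algebraMap ℝ 𝕜 ‖a‖ ∈ resolventSet 𝕜 a := by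
    have := h.1
    rwa [spectrum.notMem_iff, real_algebraMap] at this
  have h2 : -algebraMap ℝ 𝕜 ‖a‖ ∈ resolventSet 𝕜 a := by
    have := h.2
    rwa [spectrum.notMem_iff, real_algebraMap, map_neg] at this
  obtain ⟨c, hc0, hc⟩ := a.abs_rayleighQuotient_le_of_norm_mem_resolventSet h1 h2
  have := a.norm_eq_iSup_rayleighQuotient ha.isSymmetric
  grind [ciSup_le hc]

lemma isSelfAdjoint_aeval {a : H →L[𝕜] H} (ha : IsSelfAdjoint a) (p : Polynomial ℝ) :
    IsSelfAdjoint (Polynomial.aeval a p) := by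
  induction p using Polynomial.induction_on' with
  | add p q hp hq => rw [map_add]; exact hp.add hq
  | monomial n c =>
    rw [Polynomial.aeval_monomial]
    rw [← Algebra.smul_def]
    exact (IsSelfAdjoint.all c).smul (ha.pow n)

lemma isUnit_sq_add {a : H →L[𝕜] H} (ha : IsSelfAdjoint a) {t : ℝ} (ht : 0 < t) :
    IsUnit (a ^ 2 + algebraMap ℝ (H →L[𝕜] H) t) := by
  refine ContinuousLinearMap.isUnit_of_forall_le_norm_inner_map _ (c := ⟨t, ht.le⟩) ht fun v => ?_
  refine le_trans ?_ (RCLike.re_le_norm _)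
  have h1 : (a ^ 2 + algebraMap ℝ (H →L[𝕜] H) t) v = a (a v) + (t : 𝕜) • v := by
    rw [Algebra.algebraMap_eq_smul_one]
    simp [pow_two, real_smul_apply]
  have h2 : inner 𝕜 (a (a v)) v = inner 𝕜 (a v) (a v) := ha.isSymmetric (a v) v
  rw [h1, inner_add_left, h2, inner_smul_left, RCLike.conj_ofReal, map_add, RCLike.re_ofReal_mul,
    inner_self_eq_norm_sq, inner_self_eq_norm_sq]
  have : (0 : ℝ) ≤ ‖a v‖ ^ 2 := by positivity
  change ‖v‖ ^ 2 * t ≤ _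
  linarith

open Polynomial in
lemma exists_root_of_not_isUnit {a : H →L[𝕜] H} (ha : IsSelfAdjoint a) (q : ℝ[X]) (hq : q ≠ 0)
    (h : ¬ IsUnit (aeval a q)) : ∃ r ∈ spectrum ℝ a, q.eval r = 0 := by
  induction q using WfDvdMonoid.induction_on_irreducible with
  | zero => exact absurd rfl hq
  | unit u hu => exact absurd (hu.map (aeval a)) h
  | mul q i hq0 hi ih =>
    rw [map_mul] at h
    by_cases hu : IsUnit (aeval a i)
    · have h' : ¬ IsUnit (aeval a q) := fun hh => h (hu.mul hh)
      obtain ⟨r, hr, hr'⟩ := ih hq0 h'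
      exact ⟨r, hr, by simp [hr']⟩
    · have hd := hi.degree_le_two
      obtain ⟨α, β, γ, rfl⟩ : ∃ α β γ : ℝ, i = C α * X ^ 2 + C β * X + C γ :=
        ⟨_, _, _, eq_quadratic_of_degree_le_two hd⟩
      by_cases hα : α = 0
      · subst hα
        by_cases hβ : β = 0
        · subst hβ
          exfalso
          have := hi.not_isUnit
          simp only [map_zero, zero_mul, zero_add] at this hi
          have hγ : γ ≠ 0 := by
            rintro rfl
            simp at hi
          exact this (isUnit_C.mpr hγ.isUnit)
        · refine ⟨-γ / β, ?_, by
            rw [eval_mul]; refine mul_eq_zero_of_left ?_ _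
            simp; field_simp; ring⟩
          rw [spectrum.mem_iff]
          intro hh
          apply hu
          have : aeval a (C 0 * X ^ 2 + C β * X + C γ) =
              algebraMap ℝ (H →L[𝕜] H) (-β) * (algebraMap ℝ _ (-γ / β) - a) := by
            have h0 : -β * (-γ / β) = γ := by field_simp
            rw [mul_sub, ← map_mul, h0]
            simp only [map_zero, zero_mul, zero_add, map_add, map_mul, aeval_C, aeval_X, map_neg]
            noncomm_ring
          rw [this]
          exact ((neg_ne_zero.mpr hβ).isUnit.map (algebraMap ℝ (H →L[𝕜] H))).mul hh
      · by_cases hD : 0 ≤ β ^ 2 - 4 * α * γ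
        · exfalso
          have hroot : (C α * X ^ 2 + C β * X + C γ : ℝ[X]).IsRoot
              ((-β + √(β ^ 2 - 4 * α * γ)) / (2 * α)) := by
            simp only [IsRoot, eval_add, eval_mul, eval_C, eval_pow, eval_X]
            have := Real.sq_sqrt hD
            generalize √(β ^ 2 - 4 * α * γ) = s at this ⊢
            field_simp
            linear_combination this
          have h1 := degree_eq_one_of_irreducible_of_root hi hroot
          rw [degree_quadratic hα] at h1
          exact absurd h1 (by decide)
        · exfalso
          push Not at hD
          apply hu
          set t : ℝ := (4 * α * γ - β ^ 2) / (4 * α ^ 2) with ht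
          have htpos : 0 < t := by
            have : 0 < α ^ 2 := by positivity
            apply div_pos <;> nlinarith
          have hs : IsSelfAdjoint (a + algebraMap ℝ (H →L[𝕜] H) (β / (2 * α))) := by
            have := isSelfAdjoint_aeval ha (X + C (β / (2 * α)))
            simpa using this
          have : (C α * X ^ 2 + C β * X + C γ : ℝ[X]) =
              C α * ((X + C (β / (2 * α))) ^ 2 + C t) := by
            have e1 : (C β : ℝ[X]) = C α * (2 * C (β / (2 * α))) := by
              rw [← C_ofNat, ← C_mul, ← C_mul]; congr 1; field_simp
            have e2 : (C γ : ℝ[X]) = C α * (C (β / (2 * α)) ^ 2 + C t) := by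
              rw [← C_pow, ← C_add, ← C_mul]; congr 1; rw [ht]; field_simp; ring
            rw [e1, e2]; ring
          rw [this, map_mul, aeval_C, map_add, aeval_C, map_pow, map_add, aeval_X, aeval_C]
          exact (((Ne.isUnit hα)).map (algebraMap ℝ (H →L[𝕜] H))).mul (isUnit_sq_add hs htpos)

open Polynomial in
lemma norm_aeval {a : H →L[𝕜] H} (ha : IsSelfAdjoint a) (p : ℝ[X]) :
    ‖aeval a p‖ = ‖p.toContinuousMapOn (spectrum ℝ a)‖ := by
  rcases subsingleton_or_nontrivial H with hH | hH
  · have h1 : aeval a p = 0 := Subsingleton.elim _ _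
    have h2 : p.toContinuousMapOn (spectrum ℝ a) = 0 := by
      ext ⟨r, hr⟩
      rw [spectrum.of_subsingleton] at hr
      exact absurd hr (Set.notMem_empty r)
    rw [h1, h2, norm_zero]; exact (norm_zero (E := C(spectrum ℝ a, ℝ))).symm
  apply le_antisymm
  · obtain ⟨c, hc, hcm⟩ : ∃ c : ℝ, |c| = ‖aeval a p‖ ∧ c ∈ spectrum ℝ (aeval a p) := by
      rcases norm_mem_spectrum (isSelfAdjoint_aeval ha p) with h | h
      · exact ⟨_, abs_norm _, h⟩
      · exact ⟨_, by simp, h⟩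
    obtain ⟨r, hr, hpr⟩ : ∃ r ∈ spectrum ℝ a, p.eval r = c := by
      by_cases h0 : C c - p = 0
      · obtain ⟨r, hr⟩ : ∃ r, r ∈ spectrum ℝ a := (norm_mem_spectrum ha).elim (⟨_, ·⟩) (⟨_, ·⟩)
        refine ⟨r, hr, ?_⟩
        rw [← sub_eq_zero.mp h0, eval_C]
      · rw [spectrum.mem_iff] at hcm
        obtain ⟨r, hr, h⟩ := exists_root_of_not_isUnit ha (C c - p) h0 (by simpa using hcm)
        exact ⟨r, hr, by simp at h; linarith⟩
    rw [← hc, ← hpr]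
    exact (p.toContinuousMapOn (spectrum ℝ a)).norm_coe_le_norm ⟨r, hr⟩
  · rw [ContinuousMap.norm_le _ (norm_nonneg _)]
    rintro ⟨r, hr⟩
    exact abs_le_of_mem_spectrum (spectrum.subset_polynomial_aeval a p ⟨r, hr, rfl⟩)

open Polynomial in
/-- The continuous functional calculus for self-adjoint operators on a real or complex Hilbert
space; Mathlib registers it for complex scalars only. -/
instance selfAdjointCalculus : ContinuousFunctionalCalculus ℝ (H →L[𝕜] H) IsSelfAdjoint where
  predicate_zero := .zero _
  spectrum_nonempty a ha := by
    have : Nontrivial H := by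
      by_contra h
      rw [not_nontrivial_iff_subsingleton] at h
      exact not_subsingleton (H →L[𝕜] H) inferInstance
    exact (norm_mem_spectrum ha).elim (⟨_, ·⟩) (⟨_, ·⟩)
  exists_cfc_of_predicate a ha := by
    let e : ℝ[X] →ₐ[ℝ] C(spectrum ℝ a, ℝ) := toContinuousMapOnAlgHom (spectrum ℝ a)
    let f : ℝ[X] →ₐ[ℝ] (H →L[𝕜] H) := aeval a
    have hnorm : ∀ p, ‖f p‖ = ‖e p‖ := norm_aeval ha
    have hdense : DenseRange e := by
      have h1 := ContinuousMap.subalgebra_topologicalClosure_eq_top_of_separatesPoints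
        _ (polynomialFunctions_separatesPoints (spectrum ℝ a))
      have h2 : Set.range e = (polynomialFunctions (spectrum ℝ a) : Set C(spectrum ℝ a, ℝ)) := by
        rw [polynomialFunctions_coe]
      rw [DenseRange, h2, dense_iff_closure_eq, ← Subalgebra.topologicalClosure_coe, h1]
      rfl
    let Φ : C(spectrum ℝ a, ℝ) →L[ℝ] (H →L[𝕜] H) := f.toLinearMap.extendOfNorm e.toLinearMap
    have hΦ : ∀ p, Φ (e p) = f p := fun p =>
      LinearMap.extendOfNorm_eq (e := e.toLinearMap) (f := f.toLinearMap) hdense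
        ⟨1, fun p => by rw [one_mul]; exact (hnorm p).le⟩ p
    have hΦnorm : ∀ g, ‖Φ g‖ = ‖g‖ := fun g =>
      hdense.induction_on g (isClosed_eq (by fun_prop) (by fun_prop))
        fun p => by rw [hΦ, hnorm]
    have hΦmul : ∀ g h, Φ (g * h) = Φ g * Φ h := fun g h =>
      hdense.induction_on₂ (p := fun g h => Φ (g * h) = Φ g * Φ h)
        (isClosed_eq (by fun_prop) (by fun_prop))
        (fun p q => by rw [← map_mul, hΦ, hΦ, hΦ, map_mul]) g h
    have hΦsa : ∀ g, IsSelfAdjoint (Φ g) := fun g =>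
      hdense.induction_on (p := fun g => star (Φ g) = Φ g) g
        (isClosed_eq (by fun_prop) (by fun_prop))
        fun p => by rw [hΦ]; exact isSelfAdjoint_aeval ha p
    have hΦone : Φ 1 = 1 := by rw [← map_one e, hΦ, map_one]
    let φ : C(spectrum ℝ a, ℝ) →⋆ₐ[ℝ] (H →L[𝕜] H) :=
      { AlgHom.ofLinearMap Φ.toLinearMap hΦone hΦmul with
        map_star' := fun g => by
          rw [show star g = g from by ext; simp]
          exact (hΦsa g).symm }
    have hφΦ : ∀ g, φ g = Φ g := fun _ => rfl
    refine ⟨φ, Φ.continuous, fun g h hgh => ?_, ?_, fun g => ?_, hΦsa⟩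
    · rw [← sub_eq_zero, ← norm_eq_zero, ← hΦnorm, map_sub, norm_eq_zero, sub_eq_zero]
      exact hgh
    · rw [hφΦ, ← toContinuousMapOn_X_eq_restrict_id]
      exact (hΦ X).trans (aeval_X a)
    · apply subset_antisymm
      · have := AlgHom.spectrum_apply_subset φ.toAlgHom g
        rw [ContinuousMap.spectrum_eq_range] at this
        exact this
      · rintro _ ⟨s, rfl⟩
        have hcl : IsClosed {T : H →L[𝕜] H | ¬ IsUnit T} := Units.isOpen.isClosed_compl
        have hcl' : IsClosed {g : C(spectrum ℝ a, ℝ) |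
            ¬ IsUnit (algebraMap ℝ (H →L[𝕜] H) (g s) - Φ g)} := by
          refine hcl.preimage (f := fun g : C(spectrum ℝ a, ℝ) =>
            algebraMap ℝ (H →L[𝕜] H) (g s) - Φ g) ?_
          have : Continuous fun g : C(spectrum ℝ a, ℝ) => algebraMap ℝ (H →L[𝕜] H) (g s) :=
            (continuous_algebraMap ℝ (H →L[𝕜] H)).comp (by fun_prop)
          exact this.sub Φ.continuous
        rw [spectrum.mem_iff]
        refine hdense.induction_on (p := fun g : C(spectrum ℝ a, ℝ) =>
          ¬ IsUnit (algebraMap ℝ (H →L[𝕜] H) (g s) - Φ g)) g hcl' fun p => ?_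
        rw [hΦ]
        exact spectrum.subset_polynomial_aeval a p ⟨s, s.2, rfl⟩

/-- `C_c(ℝ) ∋ h ↦ ⟨h(a) w, w⟩` as a positive linear functional. -/
noncomputable def spectralFunctional (a : H →L[𝕜] H) (w : H) :
    CompactlySupportedContinuousMap ℝ ℝ →ₚ[ℝ] ℝ :=
  .mk₀
    { toFun := fun h => RCLike.re (inner 𝕜 (cfc (fun t => h t) a w) w)
      map_add' := fun g h => by
        have : cfc (fun t => (g + h) t) a = cfc (fun t => g t) a + cfc (fun t => h t) a :=
          cfc_add (a := a) _ _ g.continuous.continuousOn h.continuous.continuousOn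
        rw [this, _root_.add_apply, inner_add_left, map_add]
      map_smul' := fun r h => by
        have : cfc (fun t => (r • h) t) a = r • cfc (fun t => h t) a :=
          cfc_smul (a := a) r _ h.continuous.continuousOn
        rw [this, real_smul_apply, inner_smul_left, RCLike.conj_ofReal, RCLike.re_ofReal_mul]
        rfl }
    fun h hh => by
      have hsq : ∀ t, h t = √(h t) * √(h t) := fun t => (Real.mul_self_sqrt (hh t)).symm
      have hcont : ContinuousOn (fun t => √(h t)) (spectrum ℝ a) :=
        (Real.continuous_sqrt.comp h.continuous).continuousOn
      have h1 : cfc (fun t => h t) a = cfc (fun t => √(h t)) a * cfc (fun t => √(h t)) a := by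
        rw [← cfc_mul (a := a) _ _ hcont hcont]
        exact congrArg (fun k : ℝ → ℝ => cfc k a) (funext hsq)
      have h2 : IsSelfAdjoint (cfc (fun t => √(h t)) a) := cfc_predicate _ a
      change 0 ≤ RCLike.re (inner 𝕜 (cfc (fun t => h t) a w) w)
      rw [h1, mul_apply_eq_comp,
        show inner 𝕜 (cfc (fun t => √(h t)) a (cfc (fun t => √(h t)) a w)) w = _ from
          h2.isSymmetric (cfc (fun t => √(h t)) a w) w, ContinuousLinearMap.coe_coe,
        inner_self_eq_norm_sq]
      positivity

/-- The spectral measure of `w` with respect to the self-adjoint operator `a`, that is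
`d‖E_t w‖²` for the spectral family `E` of `a`: the Borel measure on `ℝ` with
`∫ h(t) d‖E_t w‖² = ⟨h(a) w, w⟩` for all continuous compactly supported `h`. -/
noncomputable def spectralMeasure (a : H →L[𝕜] H) (w : H) : MeasureTheory.Measure ℝ :=
  RealRMK.rieszMeasure (spectralFunctional a w)

end Calculus

end HilbertCalculus

namespace LinearFunctionalStrategy

open HilbertCalculus

section Definitions

variable {𝕜 X Y : Type*} [RCLike 𝕜]
  [NormedAddCommGroup X] [InnerProductSpace 𝕜 X] [CompleteSpace X]
  [NormedAddCommGroup Y] [InnerProductSpace 𝕜 Y] [CompleteSpace Y]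

/-- The Tikhonov filter `g_α(t) = 1 / (α + t)`. -/
noncomputable def tikhonov (α t : ℝ) : ℝ := 1 / (α + t)

/-- `T*T`. -/
noncomputable def normalOp (T : X →L[𝕜] Y) : X →L[𝕜] X := ContinuousLinearMap.adjoint T ∘L T

/-- `TT*`. -/
noncomputable def conormalOp (T : X →L[𝕜] Y) : Y →L[𝕜] Y := T ∘L ContinuousLinearMap.adjoint T

/-- The regularized solution `g_α(T*T) T* y` of `T x = y`. -/
noncomputable def regularized (g : ℝ → ℝ → ℝ) (T : X →L[𝕜] Y) (α : ℝ) (y : Y) : X :=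
  cfc (g α) (normalOp T) (ContinuousLinearMap.adjoint T y)

/-- The quasi-optimality functional `ψ(α, y) = ‖(I - T*T g_α(T*T)) x_α‖`, where `x_α` is the
regularized solution with data `y`. -/
noncomputable def psi (g : ℝ → ℝ → ℝ) (T : X →L[𝕜] Y) (α : ℝ) (y : Y) : ℝ :=
  ‖(1 - normalOp T * cfc (g α) (normalOp T)) (regularized g T α y)‖

/-- The modified functional `ψ_κ(α, y) = ‖κ(T*T) (I - T*T g_α(T*T)) x_α‖`. -/
noncomputable def psiMod (κ : ℝ → ℝ) (g : ℝ → ℝ → ℝ) (T : X →L[𝕜] Y) (α : ℝ) (y : Y) : ℝ :=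
  ‖cfc κ (normalOp T) ((1 - normalOp T * cfc (g α) (normalOp T)) (regularized g T α y))‖

/-- `α` is a minimizer of `ψ` over the parameter range `(0, αmax]`. -/
def IsArgmin (ψ : ℝ → ℝ) (αmax α : ℝ) : Prop :=
  α ∈ Set.Ioc 0 αmax ∧ ∀ β ∈ Set.Ioc 0 αmax, ψ α ≤ ψ β

/-- The noise condition of Muckenhoupt type with constant `c` for the noise element `w`:
`α² ∫_α^∞ t⁻¹ κ(t)² d‖F_t w‖² ≤ c ∫_0^α t κ(t)² d‖F_t w‖²` for all `α > 0`, where `F` is the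
spectral family of `TT*`. -/
def NoiseCondition (κ : ℝ → ℝ) (T : X →L[𝕜] Y) (c : ℝ) (w : Y) : Prop :=
  ∀ α > 0,
    α ^ 2 * ∫ t in Set.Ioi α, t⁻¹ * κ t ^ 2 ∂(spectralMeasure (conormalOp T) w) ≤
      c * ∫ t in Set.Ioc 0 α, t * κ t ^ 2 ∂(spectralMeasure (conormalOp T) w)

end Definitions

end LinearFunctionalStrategy

/-!
For a self-adjoint operator `a`, the spectral measure computes norms: `‖h(a) v‖² = ∫ h² d‖E_t v‖²`.
Through it, with `κ(t) = t ^ s`, pointwise bounds on the filters give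
`ψ_κ(α, T x) ≲ α ^ (μ + s)` for the exact data and `ψ_κ(α, w) ≲ α ^ (s - 1/2) ‖w‖` for the noise
`w`. Comparing a minimizer with `α ∼ δ ^ (2 / (2μ + 1))`, which balances the two, shows that the
minimal value of `ψ_κ` is `O(δ ^ p)` with `p = 2 (μ + s) / (2μ + 1)`.

This controls both parts of the error. The noise condition says that the propagated noise is
dominated by its frequencies up to `α`; there the filter of `ψ_κ` is comparable to `1 / α`, so the
propagated noise is bounded by `ψ_κ`. On the whole spectrum this filter is at least a multiple of
`α`, so `α ‖κ(T*T) T* T x‖ ≲ ψ_κ(α, y^δ) + α δ`; hence `α = O(δ ^ p)` if `T x ≠ 0`, and the bias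
is `O(α ^ (μ + γ)) = O(δ ^ (p (μ + γ)))`.
-/

namespace HilbertCalculus

open MeasureTheory Set

section SpectralMeasure

variable {𝕜 H : Type*} [RCLike 𝕜] [NormedAddCommGroup H] [InnerProductSpace 𝕜 H] [CompleteSpace H]

lemma isCompact_spectrum_real (a : H →L[𝕜] H) : IsCompact (spectrum ℝ a) :=
  isCompact_iff_compactSpace.mpr inferInstance

lemma spectralMeasure_compl_spectrum (a : H →L[𝕜] H) (v : H) :
    spectralMeasure a v (spectrum ℝ a)ᶜ = 0 := by
  have hclosed := (isCompact_spectrum_real a).isClosed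
  rw [spectralMeasure, hclosed.isOpen_compl.measure_eq_iSup_isCompact]
  simp only [ENNReal.iSup_eq_zero]
  intro K hKs hK
  obtain ⟨φ, hφ1, hφ0, hφc, hφ⟩ := exists_continuous_one_zero_of_isCompact hK hclosed
    (disjoint_left.mpr fun t ht ht' => hKs ht ht')
  have hzero : spectralFunctional a v ⟨φ, hφc⟩ = 0 := by
    change RCLike.re (inner 𝕜 (cfc (fun t => φ t) a v) v) = 0
    rw [cfc_congr (g := fun _ => 0) fun t ht => hφ0 ht, cfc_const_zero]
    simp
  refine le_antisymm ((RealRMK.rieszMeasure_le_of_eq_one (spectralFunctional a v)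
    (f := ⟨φ, hφc⟩) (fun t => (hφ t).1) hK hφ1).trans ?_) zero_le
  rw [hzero, ENNReal.ofReal_zero]

lemma ae_mem_spectrum (a : H →L[𝕜] H) (v : H) :
    ∀ᵐ t ∂spectralMeasure a v, t ∈ spectrum ℝ a :=
  spectralMeasure_compl_spectrum a v

lemma exists_compactlySupported_eqOn_spectrum (a : H →L[𝕜] H) {h : ℝ → ℝ}
    (hh : ContinuousOn h (spectrum ℝ a)) :
    ∃ k : CompactlySupportedContinuousMap ℝ ℝ, EqOn h k (spectrum ℝ a) := by
  have hcompact := isCompact_spectrum_real a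
  obtain ⟨χ, hχ1, -, hχc, -⟩ := exists_continuous_one_zero_of_isCompact hcompact isClosed_empty
    (disjoint_empty _)
  obtain ⟨g, hg⟩ := ContinuousMap.exists_restrict_eq hcompact.isClosed
    ⟨_, continuousOn_iff_continuous_domRestrict.mp hh⟩
  refine ⟨⟨χ * g, hχc.mul_right⟩, fun t ht => ?_⟩
  have hgt : g t = h t := DFunLike.congr_fun hg ⟨t, ht⟩
  change h t = χ t * g t
  rw [hχ1 ht, hgt, Pi.one_apply, one_mul]

lemma ae_eq_of_eqOn_spectrum {a : H →L[𝕜] H} {h k : ℝ → ℝ} (hhk : EqOn h k (spectrum ℝ a))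
    (v : H) : h =ᵐ[spectralMeasure a v] k :=
  (ae_mem_spectrum a v).mono fun _ ht => hhk ht

lemma integrable_spectralMeasure (a : H →L[𝕜] H) {h : ℝ → ℝ} (hh : ContinuousOn h (spectrum ℝ a))
    (v : H) : Integrable h (spectralMeasure a v) := by
  obtain ⟨k, hk⟩ := exists_compactlySupported_eqOn_spectrum a hh
  have hint : Integrable k (RealRMK.rieszMeasure (spectralFunctional a v)) :=
    k.continuous.integrable_of_hasCompactSupport k.hasCompactSupport
  exact hint.congr (ae_eq_of_eqOn_spectrum hk v).symm

lemma integral_spectralMeasure (a : H →L[𝕜] H) {h : ℝ → ℝ} (hh : ContinuousOn h (spectrum ℝ a))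
    (v : H) : ∫ t, h t ∂spectralMeasure a v = RCLike.re (inner 𝕜 (cfc h a v) v) := by
  obtain ⟨k, hk⟩ := exists_compactlySupported_eqOn_spectrum a hh
  rw [integral_congr_ae (ae_eq_of_eqOn_spectrum hk v), cfc_congr hk]
  exact RealRMK.integral_rieszMeasure (spectralFunctional a v) k

end SpectralMeasure

section NormEstimates

variable {𝕜 H : Type*} [RCLike 𝕜] [NormedAddCommGroup H] [InnerProductSpace 𝕜 H] [CompleteSpace H]
  {a : H →L[𝕜] H} {h k : ℝ → ℝ}

lemma cfc_mul_apply (hh : ContinuousOn h (spectrum ℝ a)) (hk : ContinuousOn k (spectrum ℝ a))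
    (v : H) : cfc (fun t => h t * k t) a v = cfc h a (cfc k a v) := by
  rw [cfc_mul h k a hh hk, mul_apply_eq_comp]

lemma cfc_one_apply (ha : IsSelfAdjoint a) (v : H) : cfc (fun _ : ℝ => (1 : ℝ)) a v = v := by
  rw [cfc_const_one ℝ a]
  rfl

lemma inner_cfc_apply_left (h : ℝ → ℝ) (a : H →L[𝕜] H) (u v : H) :
    inner 𝕜 (cfc h a u) v = inner 𝕜 u (cfc h a v) :=
  (cfc_predicate h a : IsSelfAdjoint (cfc h a)).isSymmetric u v

lemma norm_inner_cfc_apply_le (h : ℝ → ℝ) (a : H →L[𝕜] H) (u v : H) :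
    ‖inner 𝕜 (cfc h a u) v‖ ≤ ‖u‖ * ‖cfc h a v‖ := by
  rw [inner_cfc_apply_left]
  exact norm_inner_le_norm u _

lemma norm_sq_cfc_apply (hh : ContinuousOn h (spectrum ℝ a)) (v : H) :
    ‖cfc h a v‖ ^ 2 = ∫ t, h t ^ 2 ∂spectralMeasure a v := by
  have hhh : ContinuousOn (fun t => h t * h t) (spectrum ℝ a) := hh.mul hh
  simp only [pow_two (h _)]
  rw [integral_spectralMeasure a hhh, cfc_mul_apply hh hh, inner_cfc_apply_left,
    inner_self_eq_norm_sq]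

lemma norm_cfc_apply_le_mul (hh : ContinuousOn h (spectrum ℝ a))
    (hk : ContinuousOn k (spectrum ℝ a)) {r : ℝ} (hr : 0 ≤ r)
    (hle : ∀ t ∈ spectrum ℝ a, |h t| ≤ r * |k t|) (v : H) :
    ‖cfc h a v‖ ≤ r * ‖cfc k a v‖ := by
  refine le_of_sq_le_sq ?_ (by positivity)
  rw [mul_pow, norm_sq_cfc_apply hh, norm_sq_cfc_apply hk, ← integral_const_mul]
  refine integral_mono_ae (integrable_spectralMeasure a (hh.pow 2) v)
    ((integrable_spectralMeasure a (hk.pow 2) v).const_mul _) ?_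
  filter_upwards [ae_mem_spectrum a v] with t ht
  rw [← sq_abs, ← sq_abs (k t), ← mul_pow]
  gcongr
  exact hle t ht

lemma norm_cfc_apply_le (ha : IsSelfAdjoint a) (hh : ContinuousOn h (spectrum ℝ a)) {r : ℝ}
    (hr : 0 ≤ r) (hle : ∀ t ∈ spectrum ℝ a, |h t| ≤ r) (v : H) :
    ‖cfc h a v‖ ≤ r * ‖v‖ := by
  have := norm_cfc_apply_le_mul hh (continuousOn_const (c := (1 : ℝ))) hr
    (fun t ht => by simpa using hle t ht) v
  rwa [cfc_one_apply ha] at this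

lemma cfc_apply_eq_zero_of_imp (hh : ContinuousOn h (spectrum ℝ a))
    (hk : ContinuousOn k (spectrum ℝ a)) (hhk : ∀ t ∈ spectrum ℝ a, h t = 0 → k t = 0) {v : H}
    (hv : cfc h a v = 0) : cfc k a v = 0 := by
  have hint : ∫ t, h t ^ 2 ∂spectralMeasure a v = 0 := by
    rw [← norm_sq_cfc_apply hh, hv, norm_zero, zero_pow two_ne_zero]
  rw [integral_eq_zero_iff_of_nonneg (fun t => sq_nonneg (h t))
    (integrable_spectralMeasure a (hh.pow 2) v)] at hint
  rw [← norm_eq_zero, ← sq_eq_zero_iff, norm_sq_cfc_apply hk]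
  refine integral_eq_zero_of_ae ?_
  filter_upwards [hint, ae_mem_spectrum a v] with t hht ht
  have hkt : k t = 0 := hhk t ht (pow_eq_zero_iff two_ne_zero |>.mp hht)
  rw [hkt, Pi.zero_apply, zero_pow two_ne_zero]

lemma spectrum_subset_Ici (ha : a.IsPositive) : spectrum ℝ a ⊆ Ici 0 :=
  fun t ht => SpectrumRestricts.nnreal_iff.mp ha.spectrumRestricts t ht

end NormEstimates

section Intertwining

variable {𝕜 H K : Type*} [RCLike 𝕜]
  [NormedAddCommGroup H] [InnerProductSpace 𝕜 H] [CompleteSpace H]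
  [NormedAddCommGroup K] [InnerProductSpace 𝕜 K] [CompleteSpace K]
  {a : H →L[𝕜] H} {b : K →L[𝕜] K} {S : K →L[𝕜] H}

lemma cfcHomSuperset_intertwine (ha : IsSelfAdjoint a) (hb : IsSelfAdjoint b)
    (hS : ∀ w, a (S w) = S (b w)) (h : C(↑(spectrum ℝ a ∪ spectrum ℝ b), ℝ)) (w : K) :
    cfcHomSuperset ha subset_union_left h (S w) =
      S (cfcHomSuperset hb subset_union_right h w) := by
  have : CompactSpace ↑(spectrum ℝ a ∪ spectrum ℝ b) :=
    isCompact_iff_compactSpace.mp ((isCompact_spectrum_real a).union (isCompact_spectrum_real b))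
  induction h using ContinuousMap.induction_on_of_compact generalizing w with
  | const r =>
    have hconst : ContinuousMap.const ↑(spectrum ℝ a ∪ spectrum ℝ b) r = algebraMap ℝ _ r := rfl
    rw [hconst, AlgHomClass.commutes, AlgHomClass.commutes, Algebra.algebraMap_eq_smul_one,
      Algebra.algebraMap_eq_smul_one, real_smul_apply, real_smul_apply, map_smul]
    rfl
  | id => rw [cfcHomSuperset_id, cfcHomSuperset_id, hS]
  | star_id => rw [map_star, map_star, cfcHomSuperset_id, cfcHomSuperset_id, ha.star_eq,
      hb.star_eq, hS]
  | add f g hf hg => simp only [map_add, _root_.add_apply, hf, hg]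
  | mul f g hf hg => simp only [map_mul, mul_apply_eq_comp, hf, hg]
  | frequently f hf =>
    have hfw := hf.mono fun g hg => hg w
    have ha' := cfcHomSuperset_continuous ha (subset_union_left (t := spectrum ℝ b))
    have hb' := cfcHomSuperset_continuous hb (subset_union_right (s := spectrum ℝ a))
    exact hfw.mem_of_closed (isClosed_eq (by fun_prop) (by fun_prop))

lemma cfc_intertwine (ha : IsSelfAdjoint a) (hb : IsSelfAdjoint b)
    (hS : ∀ w, a (S w) = S (b w)) {h : ℝ → ℝ} (hh : ContinuousOn h (spectrum ℝ a ∪ spectrum ℝ b))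
    (w : K) : cfc h a (S w) = S (cfc h b w) := by
  rw [cfc_apply h a ha (hh.mono subset_union_left), cfc_apply h b hb (hh.mono subset_union_right)]
  exact cfcHomSuperset_intertwine ha hb hS ⟨_, hh.domRestrict⟩ w

end Intertwining

end HilbertCalculus

namespace LinearFunctionalStrategy

open HilbertCalculus MeasureTheory Set
open ContinuousLinearMap (adjoint)

section Scalar

/-- The filter `(1 - t g_α(t)) g_α(t)` which the quasi-optimality functionals apply to `T* y`, for
the Tikhonov filter `g_α`. -/
noncomputable def quasiOptFilter (α t : ℝ) : ℝ := α / (α + t) ^ 2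

variable {α t s : ℝ}

lemma continuousOn_rpow (hs : 0 ≤ s) : ContinuousOn (fun t : ℝ => t ^ s) (Ici 0) :=
  (Real.continuous_rpow_const hs).continuousOn

lemma continuousOn_tikhonov (hα : 0 < α) : ContinuousOn (tikhonov α) (Ici 0) :=
  continuousOn_const.div (by fun_prop) fun _ ht => (add_pos_of_pos_of_nonneg hα ht).ne'

lemma continuousOn_residual (hα : 0 < α) : ContinuousOn (fun t => α / (α + t)) (Ici 0) :=
  continuousOn_const.div (by fun_prop) fun _ ht => (add_pos_of_pos_of_nonneg hα ht).ne'

lemma continuousOn_quasiOptFilter (hα : 0 < α) : ContinuousOn (quasiOptFilter α) (Ici 0) :=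
  continuousOn_const.div (by fun_prop) fun _ ht =>
    pow_ne_zero 2 (add_pos_of_pos_of_nonneg hα ht).ne'

lemma quasiOptFilter_pos (hα : 0 < α) (ht : 0 ≤ t) : 0 < quasiOptFilter α t := by
  unfold quasiOptFilter
  positivity

lemma one_sub_mul_tikhonov (hα : 0 < α) (ht : 0 ≤ t) : 1 - t * tikhonov α t = α / (α + t) := by
  have : α + t ≠ 0 := (add_pos_of_pos_of_nonneg hα ht).ne'
  unfold tikhonov
  field_simp
  ring

lemma tikhonov_pos (hα : 0 < α) (ht : 0 ≤ t) : 0 < tikhonov α t := by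
  unfold tikhonov
  positivity

lemma left_mul_tikhonov_le_one (hα : 0 < α) (ht : 0 ≤ t) : α * tikhonov α t ≤ 1 := by
  rw [tikhonov, mul_one_div]
  exact div_le_one_of_le₀ (by linarith) (by positivity)

lemma right_mul_tikhonov_le_one (hα : 0 < α) (ht : 0 ≤ t) : t * tikhonov α t ≤ 1 := by
  rw [tikhonov, mul_one_div]
  exact div_le_one_of_le₀ (by linarith) (by positivity)

lemma one_le_four_mul_quasiOptFilter (hα : 0 < α) (ht : t ∈ Ioc 0 α) :
    1 ≤ 4 * α * quasiOptFilter α t := by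
  have hαt : 0 < α + t := add_pos hα ht.1
  rw [quasiOptFilter, ← mul_div_assoc, le_div_iff₀ (by positivity)]
  nlinarith [ht.2]

lemma div_add_mul_tikhonov (α t : ℝ) : α / (α + t) * tikhonov α t = quasiOptFilter α t := by
  rw [tikhonov, quasiOptFilter, div_mul_div_comm, mul_one, ← pow_two]

lemma div_add_mul_rpow_le (hα : 0 < α) (ht : 0 ≤ t) (hs : 0 ≤ s) (hs1 : s ≤ 1) :
    α / (α + t) * t ^ s ≤ α ^ s := by
  have hαt : 0 < α + t := add_pos_of_pos_of_nonneg hα ht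
  have hinterp : t ^ s * α ^ (1 - s) ≤ α + t :=
    calc t ^ s * α ^ (1 - s) ≤ (α + t) ^ s * (α + t) ^ (1 - s) := by gcongr <;> linarith
      _ = α + t := by rw [← Real.rpow_add hαt, add_sub_cancel, Real.rpow_one]
  rw [div_mul_eq_mul_div, div_le_iff₀ hαt]
  calc α * t ^ s = α ^ s * (t ^ s * α ^ (1 - s)) := by
        rw [mul_left_comm, ← Real.rpow_add hα, add_sub_cancel, Real.rpow_one, mul_comm]
    _ ≤ α ^ s * (α + t) := by gcongr

end Scalar

section Operators

variable {𝕜 X Y : Type*} [RCLike 𝕜]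
  [NormedAddCommGroup X] [InnerProductSpace 𝕜 X] [CompleteSpace X]
  [NormedAddCommGroup Y] [InnerProductSpace 𝕜 Y] [CompleteSpace Y]
  (T : X →L[𝕜] Y)

lemma normalOp_isPositive : (normalOp T).IsPositive :=
  ContinuousLinearMap.isPositive_adjoint_comp_self T

lemma conormalOp_isPositive : (conormalOp T).IsPositive :=
  ContinuousLinearMap.isPositive_self_comp_adjoint T

lemma spectrum_normalOp_subset : spectrum ℝ (normalOp T) ⊆ Ici 0 :=
  spectrum_subset_Ici (normalOp_isPositive T)

lemma spectrum_conormalOp_subset : spectrum ℝ (conormalOp T) ⊆ Ici 0 :=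
  spectrum_subset_Ici (conormalOp_isPositive T)

lemma cfc_rpow_zero (v : X) : cfc (fun t : ℝ => t ^ (0 : ℝ)) (normalOp T) v = v := by
  simp only [Real.rpow_zero]
  exact cfc_one_apply (normalOp_isPositive T).isSelfAdjoint v

lemma cfc_id_normalOp_apply (v : X) :
    cfc (fun t : ℝ => t) (normalOp T) v = adjoint T (T v) := by
  rw [cfc_id' ℝ (normalOp T) (normalOp_isPositive T).isSelfAdjoint]
  rfl

variable {T} {h k : ℝ → ℝ}

lemma cfc_mul_normalOp_apply (hh : ContinuousOn h (Ici 0)) (hk : ContinuousOn k (Ici 0)) (v : X) :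
    cfc (fun t => h t * k t) (normalOp T) v = cfc h (normalOp T) (cfc k (normalOp T) v) :=
  cfc_mul_apply (hh.mono (spectrum_normalOp_subset T)) (hk.mono (spectrum_normalOp_subset T)) v

lemma norm_cfc_normalOp_le (hh : ContinuousOn h (Ici 0)) {r : ℝ} (hr : 0 ≤ r)
    (hle : ∀ t, 0 ≤ t → |h t| ≤ r) (v : X) : ‖cfc h (normalOp T) v‖ ≤ r * ‖v‖ :=
  norm_cfc_apply_le (normalOp_isPositive T).isSelfAdjoint (hh.mono (spectrum_normalOp_subset T)) hr
    (fun t ht => hle t (spectrum_normalOp_subset T ht)) v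

lemma cfc_normalOp_adjoint (hh : ContinuousOn h (Ici 0)) (w : Y) :
    cfc h (normalOp T) (adjoint T w) = adjoint T (cfc h (conormalOp T) w) :=
  cfc_intertwine (normalOp_isPositive T).isSelfAdjoint (conormalOp_isPositive T).isSelfAdjoint
    (fun _ => rfl)
    (hh.mono (union_subset (spectrum_normalOp_subset T) (spectrum_conormalOp_subset T))) w

lemma norm_adjoint_apply (u : Y) : ‖adjoint T u‖ = ‖cfc Real.sqrt (conormalOp T) u‖ := by
  have hB := (conormalOp_isPositive T).isSelfAdjoint
  have hsq : EqOn (fun t => √t ^ 2) (fun t => t) (spectrum ℝ (conormalOp T)) :=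
    fun t ht => Real.sq_sqrt (spectrum_conormalOp_subset T ht)
  rw [← sq_eq_sq₀ (norm_nonneg _) (norm_nonneg _),
    norm_sq_cfc_apply Real.continuous_sqrt.continuousOn,
    integral_congr_ae (ae_eq_of_eqOn_spectrum hsq u),
    integral_spectralMeasure (conormalOp T) (continuousOn_id' _), cfc_id' ℝ (conormalOp T) hB,
    ← inner_self_eq_norm_sq (𝕜 := 𝕜), ContinuousLinearMap.adjoint_inner_right]
  rfl

lemma norm_cfc_adjoint (hh : ContinuousOn h (Ici 0)) (w : Y) :
    ‖cfc h (normalOp T) (adjoint T w)‖ = ‖cfc (fun t => √t * h t) (conormalOp T) w‖ := by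
  rw [cfc_normalOp_adjoint hh, norm_adjoint_apply,
    cfc_mul_apply Real.continuous_sqrt.continuousOn (hh.mono (spectrum_conormalOp_subset T))]

lemma continuousOn_sqrt_mul (hh : ContinuousOn h (Ici 0)) :
    ContinuousOn (fun t => √t * h t) (spectrum ℝ (conormalOp T)) :=
  Real.continuous_sqrt.continuousOn.mul (hh.mono (spectrum_conormalOp_subset T))

lemma norm_cfc_adjoint_le (hh : ContinuousOn h (Ici 0)) {r : ℝ} (hr : 0 ≤ r)
    (hle : ∀ t, 0 ≤ t → √t * |h t| ≤ r) (w : Y) :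
    ‖cfc h (normalOp T) (adjoint T w)‖ ≤ r * ‖w‖ := by
  rw [norm_cfc_adjoint hh]
  refine norm_cfc_apply_le (conormalOp_isPositive T).isSelfAdjoint (continuousOn_sqrt_mul hh) hr
    (fun t ht => ?_) w
  rw [abs_mul, abs_of_nonneg (Real.sqrt_nonneg t)]
  exact hle t (spectrum_conormalOp_subset T ht)

lemma norm_sq_cfc_adjoint (hh : ContinuousOn h (Ici 0)) (w : Y) :
    ‖cfc h (normalOp T) (adjoint T w)‖ ^ 2 =
      ∫ t, t * h t ^ 2 ∂spectralMeasure (conormalOp T) w := by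
  rw [norm_cfc_adjoint hh, norm_sq_cfc_apply (continuousOn_sqrt_mul hh)]
  refine integral_congr_ae (ae_eq_of_eqOn_spectrum (fun t ht => ?_) w)
  rw [mul_pow, Real.sq_sqrt (spectrum_conormalOp_subset T ht)]

end Operators

section Functionals

variable {𝕜 X Y : Type*} [RCLike 𝕜]
  [NormedAddCommGroup X] [InnerProductSpace 𝕜 X] [CompleteSpace X]
  [NormedAddCommGroup Y] [InnerProductSpace 𝕜 Y] [CompleteSpace Y]
  (κ : ℝ → ℝ) (g : ℝ → ℝ → ℝ) (T : X →L[𝕜] Y) (α : ℝ)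

lemma regularized_sub (y z : Y) :
    regularized g T α (y - z) = regularized g T α y - regularized g T α z := by
  simp only [regularized, map_sub]

lemma psi_eq_psiMod (y : Y) : psi g T α y = psiMod (fun t => t ^ (0 : ℝ)) g T α y := by
  rw [psi, psiMod, cfc_rpow_zero]

lemma psiMod_le_add_sub (y z : Y) :
    psiMod κ g T α z ≤ psiMod κ g T α y + psiMod κ g T α (z - y) := by
  simp only [psiMod, regularized_sub, map_sub]
  exact norm_le_norm_add_norm_sub' _ _

lemma psiMod_sub_le (y z : Y) :
    psiMod κ g T α (z - y) ≤ psiMod κ g T α z + psiMod κ g T α y := by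
  simp only [psiMod, regularized_sub, map_sub]
  exact norm_sub_le _ _

variable {κ α} (hα : 0 < α)
include hα

lemma one_sub_normalOp_mul_cfc_tikhonov :
    1 - normalOp T * cfc (tikhonov α) (normalOp T) =
      cfc (fun t => α / (α + t)) (normalOp T) := by
  have hA := (normalOp_isPositive T).isSelfAdjoint
  have hid : ContinuousOn (fun t : ℝ => t) (spectrum ℝ (normalOp T)) := continuousOn_id
  have hg := (continuousOn_tikhonov hα).mono (spectrum_normalOp_subset T)
  rw [← cfc_congr fun t ht => one_sub_mul_tikhonov hα (spectrum_normalOp_subset T ht),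
    cfc_sub (fun _ => 1) (fun t => t * tikhonov α t) _ continuousOn_const (hid.mul hg),
    cfc_mul _ _ _ hid hg, cfc_const_one ℝ (normalOp T) hA, cfc_id' ℝ (normalOp T) hA]

lemma sub_regularized_tikhonov (x : X) :
    x - regularized tikhonov T α (T x) = cfc (fun t => α / (α + t)) (normalOp T) x := by
  have hA := (normalOp_isPositive T).isSelfAdjoint
  have hg := (continuousOn_tikhonov hα).mono (spectrum_normalOp_subset T)
  rw [← one_sub_normalOp_mul_cfc_tikhonov T hα]
  exact congrArg (x - ·) (cfc_intertwine hA hA (fun _ => rfl) (by rwa [union_self]) x)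

lemma psiMod_tikhonov (hκ : ContinuousOn κ (Ici 0)) (z : Y) :
    psiMod κ tikhonov T α z =
      ‖cfc (fun t => κ t * quasiOptFilter α t) (normalOp T) (adjoint T z)‖ := by
  rw [psiMod, one_sub_normalOp_mul_cfc_tikhonov T hα, regularized,
    ← cfc_mul_normalOp_apply (continuousOn_residual hα) (continuousOn_tikhonov hα),
    cfc_congr fun t _ => div_add_mul_tikhonov α t,
    ← cfc_mul_normalOp_apply hκ (continuousOn_quasiOptFilter hα)]

end Functionals

section Deterministic

variable {𝕜 X Y : Type*} [RCLike 𝕜]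
  [NormedAddCommGroup X] [InnerProductSpace 𝕜 X] [CompleteSpace X]
  [NormedAddCommGroup Y] [InnerProductSpace 𝕜 Y] [CompleteSpace Y]
  {T : X →L[𝕜] Y} {α μ s : ℝ}

lemma apply_eq_zero_of_cfc_rpow_adjoint_eq_zero (hs : 0 ≤ s) {x : X}
    (hx : cfc (fun t : ℝ => t ^ s) (normalOp T) (adjoint T (T x)) = 0) : T x = 0 := by
  have hcs : ContinuousOn (fun t : ℝ => t ^ s * t) (Ici 0) :=
    (continuousOn_rpow hs).mul continuousOn_id
  have hspec := spectrum_normalOp_subset T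
  rw [← cfc_id_normalOp_apply, ← cfc_mul_normalOp_apply (continuousOn_rpow hs)
    (continuousOn_id' _)] at hx
  have hA : adjoint T (T x) = 0 := by
    rw [← cfc_id_normalOp_apply]
    refine cfc_apply_eq_zero_of_imp (hcs.mono hspec) continuousOn_id (fun t ht h0 => ?_) hx
    rcases mul_eq_zero.mp h0 with h | h
    · exact ((Real.rpow_eq_zero_iff_of_nonneg (hspec ht)).mp h).1
    · exact h
  have hker : x ∈ LinearMap.ker (adjoint T ∘L T).toLinearMap := hA
  rwa [ContinuousLinearMap.ker_adjoint_comp_self] at hker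

lemma eq_zero_of_cfc_rpow_of_apply_eq_zero (hμ : 0 < μ) {x v : X}
    (hx : x = cfc (fun t : ℝ => t ^ μ) (normalOp T) v) (hTx : T x = 0) : x = 0 := by
  have hcs : ContinuousOn (fun t : ℝ => t * t ^ μ) (Ici 0) :=
    continuousOn_id.mul (continuousOn_rpow hμ.le)
  have hspec := spectrum_normalOp_subset T
  have hA : cfc (fun t : ℝ => t * t ^ μ) (normalOp T) v = 0 := by
    rw [cfc_mul_normalOp_apply (continuousOn_id' _) (continuousOn_rpow hμ.le), ← hx,
      cfc_id_normalOp_apply, hTx, map_zero]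
  rw [hx]
  refine cfc_apply_eq_zero_of_imp (hcs.mono hspec) ((continuousOn_rpow hμ.le).mono hspec)
    (fun t _ h0 => ?_) hA
  rcases mul_eq_zero.mp h0 with h | h
  · rw [h, Real.zero_rpow hμ.ne']
  · exact h

lemma psiMod_rpow_le (hα : 0 < α) (hs : s ∈ Icc (0 : ℝ) (1 / 2)) (w : Y) :
    psiMod (fun t : ℝ => t ^ s) tikhonov T α w ≤ α ^ (s - 1 / 2) * ‖w‖ := by
  have hc : ContinuousOn (fun t : ℝ => t ^ s * quasiOptFilter α t) (Ici 0) :=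
    (continuousOn_rpow hs.1).mul (continuousOn_quasiOptFilter hα)
  rw [psiMod_tikhonov T hα (continuousOn_rpow hs.1)]
  refine norm_cfc_adjoint_le hc (by positivity) (fun t ht => ?_) w
  have hαt : α ≤ α + t := le_add_of_nonneg_right ht
  have hinterp : α / (α + t) * t ^ (s + 1 / 2) ≤ α ^ (s + 1 / 2) :=
    div_add_mul_rpow_le hα ht (by linarith [hs.1]) (by linarith [hs.2])
  have hq := (quasiOptFilter_pos hα ht).le
  rw [abs_of_nonneg (by positivity)]
  calc √t * (t ^ s * quasiOptFilter α t)
      = α / (α + t) * t ^ (s + 1 / 2) / (α + t) := by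
        rw [Real.rpow_add_of_nonneg ht hs.1 (by norm_num), ← Real.sqrt_eq_rpow, quasiOptFilter]
        field_simp
    _ ≤ α ^ (s + 1 / 2) / α := by gcongr
    _ = α ^ (s - 1 / 2) := by
        rw [div_eq_iff hα.ne', ← Real.rpow_add_one hα.ne']
        ring_nf

lemma psiMod_rpow_apply_le (hα : 0 < α) (hμ : 0 ≤ μ) (hs : 0 ≤ s) (hμs : μ + s ≤ 1) {x v : X}
    (hx : x = cfc (fun t : ℝ => t ^ μ) (normalOp T) v) :
    psiMod (fun t : ℝ => t ^ s) tikhonov T α (T x) ≤ α ^ (μ + s) * ‖v‖ := by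
  have hcq : ContinuousOn (fun t : ℝ => t ^ s * quasiOptFilter α t) (Ici 0) :=
    (continuousOn_rpow hs).mul (continuousOn_quasiOptFilter hα)
  have hcx : ContinuousOn (fun t : ℝ => t * t ^ μ) (Ici 0) :=
    continuousOn_id.mul (continuousOn_rpow hμ)
  rw [psiMod_tikhonov T hα (continuousOn_rpow hs), ← cfc_id_normalOp_apply, hx,
    ← cfc_mul_normalOp_apply (continuousOn_id' _) (continuousOn_rpow hμ),
    ← cfc_mul_normalOp_apply hcq hcx]
  have hc : ContinuousOn (fun t : ℝ => t ^ s * quasiOptFilter α t * (t * t ^ μ)) (Ici 0) :=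
    hcq.mul hcx
  refine norm_cfc_normalOp_le hc (by positivity) (fun t ht => ?_) v
  have hq := (quasiOptFilter_pos hα ht).le
  have hfrac : t / (α + t) ≤ 1 := div_le_one_of_le₀ (by linarith) (by positivity)
  rw [abs_of_nonneg (by positivity)]
  calc t ^ s * quasiOptFilter α t * (t * t ^ μ)
      = α / (α + t) * t ^ (μ + s) * (t / (α + t)) := by
        rw [Real.rpow_add_of_nonneg ht hμ hs, quasiOptFilter]
        field_simp
    _ ≤ α ^ (μ + s) * 1 := by
        gcongr
        exact div_add_mul_rpow_le hα ht (by positivity) hμs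
    _ = α ^ (μ + s) := mul_one _

lemma norm_cfc_rpow_sub_regularized_le (hα : 0 < α) (hμ : 0 ≤ μ) (hs : 0 ≤ s) (hμs : μ + s ≤ 1)
    {x v : X} (hx : x = cfc (fun t : ℝ => t ^ μ) (normalOp T) v) :
    ‖cfc (fun t : ℝ => t ^ s) (normalOp T) (x - regularized tikhonov T α (T x))‖ ≤
      α ^ (μ + s) * ‖v‖ := by
  have hcr : ContinuousOn (fun t : ℝ => t ^ s * (α / (α + t))) (Ici 0) :=
    (continuousOn_rpow hs).mul (continuousOn_residual hα)
  rw [sub_regularized_tikhonov T hα, hx,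
    ← cfc_mul_normalOp_apply (continuousOn_rpow hs) (continuousOn_residual hα),
    ← cfc_mul_normalOp_apply hcr (continuousOn_rpow hμ)]
  have hc : ContinuousOn (fun t : ℝ => t ^ s * (α / (α + t)) * t ^ μ) (Ici 0) :=
    hcr.mul (continuousOn_rpow hμ)
  refine norm_cfc_normalOp_le hc (by positivity) (fun t ht => ?_) v
  rw [abs_of_nonneg (by positivity)]
  calc t ^ s * (α / (α + t)) * t ^ μ = α / (α + t) * t ^ (μ + s) := by
        rw [Real.rpow_add_of_nonneg ht hμ hs]
        ring
    _ ≤ α ^ (μ + s) := div_add_mul_rpow_le hα ht (by positivity) hμs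

lemma mul_norm_cfc_adjoint_le_psiMod {κ : ℝ → ℝ} (hκ : ContinuousOn κ (Ici 0)) {αmax : ℝ}
    (hα : α ∈ Ioc 0 αmax) (z : Y) :
    α * ‖cfc κ (normalOp T) (adjoint T z)‖ ≤
      (αmax + ‖normalOp T‖) ^ 2 * psiMod κ tikhonov T α z := by
  have hspec := spectrum_normalOp_subset T
  have hcq : ContinuousOn (fun t => κ t * quasiOptFilter α t) (Ici 0) :=
    hκ.mul (continuousOn_quasiOptFilter hα.1)
  rw [psiMod_tikhonov T hα.1 hκ, ← le_div_iff₀' hα.1, ← div_mul_eq_mul_div]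
  have hα0 := hα.1.le
  refine norm_cfc_apply_le_mul (hκ.mono hspec) (hcq.mono hspec) (by positivity)
    (fun t ht => ?_) _
  have ht0 : 0 ≤ t := hspec ht
  have hαt : α + t ≤ αmax + ‖normalOp T‖ :=
    add_le_add hα.2 ((le_abs_self t).trans (abs_le_of_mem_spectrum ht))
  have hαt0 : 0 < α + t := add_pos_of_pos_of_nonneg hα.1 ht0
  calc |κ t| = (α + t) ^ 2 / α * (|κ t| * quasiOptFilter α t) := by
        have := hα.1.ne'
        rw [quasiOptFilter]
        field_simp
    _ ≤ (αmax + ‖normalOp T‖) ^ 2 / α * (|κ t| * quasiOptFilter α t) := by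
        have := (quasiOptFilter_pos hα.1 ht0).le
        gcongr
    _ = (αmax + ‖normalOp T‖) ^ 2 / α * |κ t * quasiOptFilter α t| := by
        rw [abs_mul, abs_of_pos (quasiOptFilter_pos hα.1 ht0)]

end Deterministic

section Noise

variable {𝕜 X Y : Type*} [RCLike 𝕜]
  [NormedAddCommGroup X] [InnerProductSpace 𝕜 X] [CompleteSpace X]
  [NormedAddCommGroup Y] [InnerProductSpace 𝕜 Y] [CompleteSpace Y]
  {T : X →L[𝕜] Y} {κ : ℝ → ℝ} {α c s γ : ℝ} {w : Y}

/-- `∫_0^α t κ(t)² d‖F_t w‖²`, where `F` is the spectral family of `TT*`: the part of the energy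
`‖κ(T*T) T* w‖²` at frequencies up to `α`, which bounds the noise in `NoiseCondition`. -/
noncomputable def lowEnergy (κ : ℝ → ℝ) (T : X →L[𝕜] Y) (α : ℝ) (w : Y) : ℝ :=
  ∫ t in Ioc 0 α, t * κ t ^ 2 ∂spectralMeasure (conormalOp T) w

lemma lowEnergy_nonneg (κ : ℝ → ℝ) (T : X →L[𝕜] Y) (α : ℝ) (w : Y) : 0 ≤ lowEnergy κ T α w :=
  setIntegral_nonneg measurableSet_Ioc fun _ ht => mul_nonneg ht.1.le (sq_nonneg _)

lemma NoiseCondition.mono (hw : NoiseCondition κ T c w) {c' : ℝ} (hc : c ≤ c') :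
    NoiseCondition κ T c' w := fun α hα =>
  (hw α hα).trans (mul_le_mul_of_nonneg_right hc (lowEnergy_nonneg κ T α w))

lemma integrable_conormalOp {F : ℝ → ℝ} (hF : ContinuousOn F (Ici 0)) (w : Y) :
    Integrable F (spectralMeasure (conormalOp T) w) :=
  integrable_spectralMeasure (conormalOp T) (hF.mono (spectrum_conormalOp_subset T)) w

lemma continuousOn_mul_sq (hκ : ContinuousOn κ (Ici 0)) :
    ContinuousOn (fun t => t * κ t ^ 2) (Ici 0) :=
  continuousOn_id.mul (hκ.pow 2)

lemma integrableOn_inv_mul_sq_Ioi (hκ : ContinuousOn κ (Ici 0)) (hα : 0 < α) (w : Y) :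
    IntegrableOn (fun t => t⁻¹ * κ t ^ 2) (Ioi α) (spectralMeasure (conormalOp T) w) := by
  have hcut : Continuous fun t => (max t α)⁻¹ :=
    (continuous_id.max continuous_const).inv₀ fun t => (lt_max_of_lt_right hα).ne'
  have hc : ContinuousOn (fun t => (max t α)⁻¹ * κ t ^ 2) (Ici 0) :=
    hcut.continuousOn.mul (hκ.pow 2)
  refine (integrable_conormalOp hc w).integrableOn.congr_fun (fun t ht => ?_) measurableSet_Ioi
  simp only [max_eq_left (mem_Ioi.mp ht).le]

lemma integral_eq_Ioc_add_Ioi {F : ℝ → ℝ} (hF : ContinuousOn F (Ici 0)) (hF0 : F 0 = 0)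
    (hα : 0 ≤ α) (w : Y) :
    ∫ t, F t ∂spectralMeasure (conormalOp T) w =
      (∫ t in Ioc 0 α, F t ∂spectralMeasure (conormalOp T) w) +
        ∫ t in Ioi α, F t ∂spectralMeasure (conormalOp T) w := by
  have hint := integrable_conormalOp (T := T) hF w
  rw [← setIntegral_union Ioc_disjoint_Ioi_same measurableSet_Ioi hint.integrableOn
    hint.integrableOn, Ioc_union_Ioi_eq_Ioi hα]
  refine (setIntegral_eq_integral_of_ae_compl_eq_zero ?_).symm
  filter_upwards [ae_mem_spectrum (conormalOp T) w] with t ht ht0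
  have ht_zero : t = 0 := le_antisymm (not_lt.mp ht0) (spectrum_conormalOp_subset T ht)
  rw [ht_zero, hF0]

lemma NoiseCondition.norm_sq_regularized_le (hκ : ContinuousOn κ (Ici 0))
    (hw : NoiseCondition κ T c w) (hα : 0 < α) :
    α ^ 2 * ‖cfc κ (normalOp T) (regularized tikhonov T α w)‖ ^ 2 ≤
      (1 + c) * lowEnergy κ T α w := by
  have hg : ContinuousOn (fun t => κ t * tikhonov α t) (Ici 0) :=
    hκ.mul (continuousOn_tikhonov hα)
  have hF : ContinuousOn (fun t => α ^ 2 * (t * (κ t * tikhonov α t) ^ 2)) (Ici 0) :=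
    continuousOn_const.mul (continuousOn_mul_sq hg)
  have hFint := integrable_conormalOp (T := T) hF w
  have hlow : ∫ t in Ioc 0 α, α ^ 2 * (t * (κ t * tikhonov α t) ^ 2)
      ∂spectralMeasure (conormalOp T) w ≤ lowEnergy κ T α w := by
    refine setIntegral_mono_on hFint.integrableOn
      (integrable_conormalOp (continuousOn_mul_sq hκ) w).integrableOn measurableSet_Ioc
      fun t ht => ?_
    have hg1 : (α * tikhonov α t) ^ 2 ≤ 1 :=
      pow_le_one₀ (mul_pos hα (tikhonov_pos hα ht.1.le)).le (left_mul_tikhonov_le_one hα ht.1.le)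
    calc α ^ 2 * (t * (κ t * tikhonov α t) ^ 2) = t * κ t ^ 2 * (α * tikhonov α t) ^ 2 := by ring
      _ ≤ t * κ t ^ 2 := mul_le_of_le_one_right (mul_nonneg ht.1.le (sq_nonneg _)) hg1
  have hhigh : ∫ t in Ioi α, α ^ 2 * (t * (κ t * tikhonov α t) ^ 2)
      ∂spectralMeasure (conormalOp T) w ≤
        α ^ 2 * ∫ t in Ioi α, t⁻¹ * κ t ^ 2 ∂spectralMeasure (conormalOp T) w := by
    rw [← integral_const_mul]
    refine setIntegral_mono_on hFint.integrableOn
      ((integrableOn_inv_mul_sq_Ioi hκ hα w).const_mul _) measurableSet_Ioi fun t ht => ?_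
    have ht0 : 0 < t := hα.trans ht
    have hg1 : (t * tikhonov α t) ^ 2 ≤ 1 :=
      pow_le_one₀ (mul_pos ht0 (tikhonov_pos hα ht0.le)).le (right_mul_tikhonov_le_one hα ht0.le)
    calc α ^ 2 * (t * (κ t * tikhonov α t) ^ 2)
        = α ^ 2 * (t⁻¹ * κ t ^ 2) * (t * tikhonov α t) ^ 2 := by field_simp
      _ ≤ α ^ 2 * (t⁻¹ * κ t ^ 2) := mul_le_of_le_one_right (by positivity) hg1
  rw [regularized, ← cfc_mul_normalOp_apply hκ (continuousOn_tikhonov hα), norm_sq_cfc_adjoint hg,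
    ← integral_const_mul, integral_eq_Ioc_add_Ioi hF (by simp) hα.le]
  calc _ ≤ lowEnergy κ T α w + c * lowEnergy κ T α w := add_le_add hlow (hhigh.trans (hw α hα))
    _ = (1 + c) * lowEnergy κ T α w := by ring

lemma lowEnergy_le_psiMod_sq (hκ : ContinuousOn κ (Ici 0)) (hα : 0 < α) (w : Y) :
    lowEnergy κ T α w ≤ 16 * α ^ 2 * psiMod κ tikhonov T α w ^ 2 := by
  have hq : ContinuousOn (fun t => κ t * quasiOptFilter α t) (Ici 0) :=
    hκ.mul (continuousOn_quasiOptFilter hα)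
  have hF : ContinuousOn (fun t => 16 * α ^ 2 * (t * (κ t * quasiOptFilter α t) ^ 2)) (Ici 0) :=
    continuousOn_const.mul (continuousOn_mul_sq hq)
  have hFint := integrable_conormalOp (T := T) hF w
  rw [psiMod_tikhonov T hα hκ, norm_sq_cfc_adjoint hq, ← integral_const_mul]
  have hpoint (t : ℝ) (ht : t ∈ Ioc 0 α) :
      t * κ t ^ 2 ≤ 16 * α ^ 2 * (t * (κ t * quasiOptFilter α t) ^ 2) :=
    calc t * κ t ^ 2 ≤ t * κ t ^ 2 * (4 * α * quasiOptFilter α t) ^ 2 :=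
          le_mul_of_one_le_right (mul_nonneg ht.1.le (sq_nonneg _))
            (one_le_pow₀ (one_le_four_mul_quasiOptFilter hα ht))
      _ = 16 * α ^ 2 * (t * (κ t * quasiOptFilter α t) ^ 2) := by ring
  calc lowEnergy κ T α w
      ≤ ∫ t in Ioc 0 α, 16 * α ^ 2 * (t * (κ t * quasiOptFilter α t) ^ 2)
          ∂spectralMeasure (conormalOp T) w :=
        setIntegral_mono_on (integrable_conormalOp (continuousOn_mul_sq hκ) w).integrableOn
          hFint.integrableOn measurableSet_Ioc hpoint
    _ ≤ _ := by
        refine setIntegral_le_integral hFint ?_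
        filter_upwards [ae_mem_spectrum (conormalOp T) w] with t ht
        have ht0 : 0 ≤ t := spectrum_conormalOp_subset T ht
        positivity

lemma lowEnergy_rpow_le (hs : 0 ≤ s) (hsγ : s ≤ γ) (α : ℝ) (w : Y) :
    lowEnergy (fun t => t ^ γ) T α w ≤ (α ^ (γ - s)) ^ 2 * lowEnergy (fun t => t ^ s) T α w := by
  have hcont {r : ℝ} (hr : 0 ≤ r) :=
    integrable_conormalOp (T := T) (continuousOn_mul_sq (continuousOn_rpow hr)) w
  rw [lowEnergy, lowEnergy, ← integral_const_mul]
  refine setIntegral_mono_on (hcont (hs.trans hsγ)).integrableOn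
    ((hcont hs).const_mul _).integrableOn measurableSet_Ioc fun t ht => ?_
  have ht0 := ht.1.le
  have hsplit : t ^ γ = t ^ (γ - s) * t ^ s := by rw [← Real.rpow_add ht.1, sub_add_cancel]
  rw [hsplit, mul_pow, mul_left_comm]
  gcongr
  exact ht.2

lemma NoiseCondition.rpow_of_le (hs : 0 ≤ s) (hsγ : s ≤ γ) (hc : 0 ≤ c)
    (hw : NoiseCondition (fun t => t ^ γ) T c w) : NoiseCondition (fun t => t ^ s) T c w := by
  intro α hα
  have hint {r : ℝ} (hr : 0 ≤ r) :=
    integrableOn_inv_mul_sq_Ioi (T := T) (continuousOn_rpow hr) hα w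
  have hhigh : (α ^ (γ - s)) ^ 2 *
      ∫ t in Ioi α, t⁻¹ * (t ^ s) ^ 2 ∂spectralMeasure (conormalOp T) w ≤
        ∫ t in Ioi α, t⁻¹ * (t ^ γ) ^ 2 ∂spectralMeasure (conormalOp T) w := by
    rw [← integral_const_mul]
    refine setIntegral_mono_on ((hint hs).const_mul _) (hint (hs.trans hsγ)) measurableSet_Ioi
      fun t ht => ?_
    have ht0 : 0 < t := hα.trans ht
    have hsplit : t ^ γ = t ^ (γ - s) * t ^ s := by rw [← Real.rpow_add ht0, sub_add_cancel]
    rw [hsplit, mul_pow, mul_left_comm]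
    have hle : α ≤ t := le_of_lt ht
    gcongr
  have hpos : 0 < (α ^ (γ - s)) ^ 2 := by positivity
  refine le_of_mul_le_mul_left ?_ hpos
  calc (α ^ (γ - s)) ^ 2 *
        (α ^ 2 * ∫ t in Ioi α, t⁻¹ * (t ^ s) ^ 2 ∂spectralMeasure (conormalOp T) w)
      ≤ α ^ 2 * ∫ t in Ioi α, t⁻¹ * (t ^ γ) ^ 2 ∂spectralMeasure (conormalOp T) w := by
        rw [mul_left_comm]
        gcongr
    _ ≤ c * lowEnergy (fun t => t ^ γ) T α w := hw α hα
    _ ≤ c * ((α ^ (γ - s)) ^ 2 * lowEnergy (fun t => t ^ s) T α w) := by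
        gcongr
        exact lowEnergy_rpow_le hs hsγ α w
    _ = (α ^ (γ - s)) ^ 2 * (c * lowEnergy (fun t => t ^ s) T α w) := mul_left_comm _ _ _

lemma NoiseCondition.norm_cfc_regularized_le (hs : 0 ≤ s) (hsγ : s ≤ γ) (hc : 0 ≤ c)
    (hw : NoiseCondition (fun t => t ^ γ) T c w) (hα : 0 < α) :
    ‖cfc (fun t : ℝ => t ^ γ) (normalOp T) (regularized tikhonov T α w)‖ ≤
      4 * √(1 + c) * α ^ (γ - s) * psiMod (fun t => t ^ s) tikhonov T α w := by
  have hψ : 0 ≤ psiMod (fun t => t ^ s) tikhonov T α w := norm_nonneg _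
  refine le_of_mul_le_mul_left (le_of_sq_le_sq ?_ (by positivity)) hα
  calc (α * ‖cfc (fun t : ℝ => t ^ γ) (normalOp T) (regularized tikhonov T α w)‖) ^ 2
      ≤ (1 + c) * lowEnergy (fun t => t ^ γ) T α w := by
        rw [mul_pow]
        exact hw.norm_sq_regularized_le (continuousOn_rpow (hs.trans hsγ)) hα
    _ ≤ (1 + c) * ((α ^ (γ - s)) ^ 2 *
          (16 * α ^ 2 * psiMod (fun t => t ^ s) tikhonov T α w ^ 2)) := by
        gcongr
        refine (lowEnergy_rpow_le hs hsγ α w).trans ?_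
        gcongr
        exact lowEnergy_le_psiMod_sq (continuousOn_rpow hs) hα w
    _ = (α * (4 * √(1 + c) * α ^ (γ - s) * psiMod (fun t => t ^ s) tikhonov T α w)) ^ 2 := by
        simp only [mul_pow]
        rw [Real.sq_sqrt (by positivity)]
        ring

end Noise

section RateExponent

/-- The order in `δ` of the minimal value of `ψ_κ` for `κ(t) = t ^ s`, data with noise level `δ`
and an exact solution in the range of `(T*T) ^ μ`. -/
noncomputable def psiRate (μ s : ℝ) : ℝ := 2 * (μ + s) / (2 * μ + 1)

variable {μ s δ : ℝ}

lemma psiRate_nonneg (hμ : 0 ≤ μ) (hs : 0 ≤ s) : 0 ≤ psiRate μ s := by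
  unfold psiRate
  positivity

lemma psiRate_le_one (hμ : 0 ≤ μ) (hs : s ≤ 1 / 2) : psiRate μ s ≤ 1 :=
  div_le_one_of_le₀ (by linarith) (by positivity)

lemma mul_rpow_psiRate_bias {a : ℝ} (ha : 0 ≤ a) (hδ : 0 ≤ δ) :
    (a * δ ^ (2 / (2 * μ + 1))) ^ (μ + s) = a ^ (μ + s) * δ ^ psiRate μ s := by
  rw [Real.mul_rpow ha (by positivity), ← Real.rpow_mul hδ, div_mul_eq_mul_div, psiRate]

lemma mul_rpow_psiRate_noise {a : ℝ} (ha : 0 ≤ a) (hμ : 0 ≤ μ) (hδ : 0 < δ) :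
    (a * δ ^ (2 / (2 * μ + 1))) ^ (s - 1 / 2) * δ = a ^ (s - 1 / 2) * δ ^ psiRate μ s := by
  have hexp : 2 / (2 * μ + 1) * (s - 1 / 2) + 1 = psiRate μ s := by
    unfold psiRate
    field_simp
    ring
  rw [Real.mul_rpow ha (by positivity), ← Real.rpow_mul hδ.le, mul_assoc,
    ← Real.rpow_add_one hδ.ne', hexp]

end RateExponent

section Rates

variable {𝕜 X Y : Type*} [RCLike 𝕜]
  [NormedAddCommGroup X] [InnerProductSpace 𝕜 X] [CompleteSpace X]
  [NormedAddCommGroup Y] [InnerProductSpace 𝕜 Y] [CompleteSpace Y]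
  {T : X →L[𝕜] Y} {μ γ s c αmax : ℝ} {x v : X}

lemma psiMod_argmin_le (hμ : 0 ≤ μ) (hs : s ∈ Icc (0 : ℝ) (1 / 2)) (hμs : μ + s ≤ 1)
    (hx : x = cfc (fun t : ℝ => t ^ μ) (normalOp T) v) {δ : ℝ} (hδ : δ ∈ Ioc (0 : ℝ) 1) {z : Y}
    (hz : ‖z - T x‖ ≤ δ) {α : ℝ}
    (hα : IsArgmin (fun β => psiMod (fun t : ℝ => t ^ s) tikhonov T β z) αmax α) :
    psiMod (fun t : ℝ => t ^ s) tikhonov T α z ≤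
      (αmax ^ (μ + s) * ‖v‖ + αmax ^ (s - 1 / 2)) * δ ^ psiRate μ s := by
  have hαmax : 0 < αmax := hα.1.1.trans_le hα.1.2
  have hδ0 := hδ.1
  -- this competitor balances the bias `β ^ (μ + s)` against the noise `β ^ (s - 1 / 2) * δ`
  set β := αmax * δ ^ (2 / (2 * μ + 1))
  have hβ : 0 < β := by positivity
  have hβmax : β ≤ αmax :=
    mul_le_of_le_one_right hαmax.le (Real.rpow_le_one hδ0.le hδ.2 (by positivity))
  calc psiMod (fun t : ℝ => t ^ s) tikhonov T α z
      ≤ psiMod (fun t : ℝ => t ^ s) tikhonov T β z := hα.2 β ⟨hβ, hβmax⟩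
    _ ≤ psiMod (fun t : ℝ => t ^ s) tikhonov T β (T x) +
          psiMod (fun t : ℝ => t ^ s) tikhonov T β (z - T x) := psiMod_le_add_sub _ _ T β _ z
    _ ≤ β ^ (μ + s) * ‖v‖ + β ^ (s - 1 / 2) * δ := by
        gcongr
        · exact psiMod_rpow_apply_le hβ hμ hs.1 hμs hx
        · exact (psiMod_rpow_le hβ hs _).trans (by gcongr)
    _ = (αmax ^ (μ + s) * ‖v‖ + αmax ^ (s - 1 / 2)) * δ ^ psiRate μ s := by
        rw [mul_rpow_psiRate_bias hαmax.le hδ0.le, mul_rpow_psiRate_noise hαmax.le hμ hδ0]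
        ring

lemma exists_argmin_le (hμ : 0 ≤ μ) (hs : s ∈ Icc (0 : ℝ) (1 / 2)) (hμs : μ + s ≤ 1)
    (hx : x = cfc (fun t : ℝ => t ^ μ) (normalOp T) v) (hTx : T x ≠ 0) :
    ∃ K, ∀ δ ∈ Ioc (0 : ℝ) 1, ∀ z, ‖z - T x‖ ≤ δ → ∀ α,
      IsArgmin (fun β => psiMod (fun t : ℝ => t ^ s) tikhonov T β z) αmax α →
        α ≤ K * δ ^ psiRate μ s := by
  set B := cfc (fun t : ℝ => t ^ s) (normalOp T) ∘L adjoint T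
  have hB : 0 < ‖B (T x)‖ :=
    norm_pos_iff.mpr fun h => hTx (apply_eq_zero_of_cfc_rpow_adjoint_eq_zero hs.1 h)
  set M := (αmax + ‖normalOp T‖) ^ 2
  set P := αmax ^ (μ + s) * ‖v‖ + αmax ^ (s - 1 / 2)
  refine ⟨(M * P + αmax * ‖B‖) / ‖B (T x)‖, fun δ hδ z hz α hα => ?_⟩
  have hα0 := hα.1.1
  have hαmax : 0 ≤ αmax := hα0.le.trans hα.1.2
  have hψ := psiMod_argmin_le hμ hs hμs hx hδ hz hα
  have hδ_le : δ ≤ δ ^ psiRate μ s :=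
    Real.self_le_rpow_of_le_one hδ.1.le hδ.2 (psiRate_le_one hμ hs.2)
  rw [div_mul_eq_mul_div, le_div_iff₀ hB]
  calc α * ‖B (T x)‖ ≤ α * (‖B z‖ + ‖B (z - T x)‖) := by
        rw [map_sub]
        gcongr
        exact norm_le_norm_add_norm_sub _ _
    _ = α * ‖B z‖ + α * ‖B (z - T x)‖ := mul_add _ _ _
    _ ≤ M * (P * δ ^ psiRate μ s) + αmax * (‖B‖ * δ ^ psiRate μ s) := by
        refine add_le_add
          ((mul_norm_cfc_adjoint_le_psiMod (continuousOn_rpow hs.1) hα.1 z).trans (by gcongr))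
          (mul_le_mul hα.1.2 (B.le_opNorm_of_le (hz.trans hδ_le)) (norm_nonneg _) hαmax)
    _ = (M * P + αmax * ‖B‖) * δ ^ psiRate μ s := by ring

lemma exists_source_argmin_rpow_le (hμ : 0 < μ) (hs : s ∈ Icc (0 : ℝ) (1 / 2)) (hμs : μ + s ≤ 1)
    (hγ : 0 ≤ γ) (hx : x = cfc (fun t : ℝ => t ^ μ) (normalOp T) v) :
    ∃ u K, x = cfc (fun t : ℝ => t ^ μ) (normalOp T) u ∧
      ∀ δ ∈ Ioc (0 : ℝ) 1, ∀ z, ‖z - T x‖ ≤ δ → ∀ α,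
        IsArgmin (fun β => psiMod (fun t : ℝ => t ^ s) tikhonov T β z) αmax α →
          α ^ (μ + γ) * ‖u‖ ≤ K * δ ^ (psiRate μ s * (μ + γ)) := by
  by_cases hTx : T x = 0
  · exact ⟨0, 0, by rw [map_zero, eq_zero_of_cfc_rpow_of_apply_eq_zero hμ hx hTx], by simp⟩
  obtain ⟨K, hK⟩ := exists_argmin_le (αmax := αmax) hμ.le hs hμs hx hTx
  refine ⟨v, K ^ (μ + γ) * ‖v‖, hx, fun δ hδ z hz α hα => ?_⟩
  have hδ0 := hδ.1
  have hαK := hK δ hδ z hz α hα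
  have hK0 : 0 < K := pos_of_mul_pos_left (hα.1.1.trans_le hαK) (by positivity)
  calc α ^ (μ + γ) * ‖v‖ ≤ (K * δ ^ psiRate μ s) ^ (μ + γ) * ‖v‖ := by
        have := hα.1.1.le
        gcongr
    _ = K ^ (μ + γ) * ‖v‖ * δ ^ (psiRate μ s * (μ + γ)) := by
        rw [Real.mul_rpow hK0.le (by positivity), ← Real.rpow_mul hδ0.le]
        ring

lemma norm_cfc_rpow_error_le (hμ : 0 ≤ μ) (hs : 0 ≤ s) (hsγ : s ≤ γ) (hμγ : μ + γ ≤ 1)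
    (hc : 0 ≤ c) (hx : x = cfc (fun t : ℝ => t ^ μ) (normalOp T) v) {α : ℝ}
    (hα : α ∈ Ioc 0 αmax) {z : Y} (hz : NoiseCondition (fun t : ℝ => t ^ γ) T c (z - T x)) :
    ‖cfc (fun t : ℝ => t ^ γ) (normalOp T) (regularized tikhonov T α z - x)‖ ≤
      4 * √(1 + c) * αmax ^ (γ - s) * psiMod (fun t : ℝ => t ^ s) tikhonov T α z +
        (4 * √(1 + c) + 1) * (α ^ (μ + γ) * ‖v‖) := by
  have hα0 := hα.1
  have hψ0 : 0 ≤ psiMod (fun t : ℝ => t ^ s) tikhonov T α z := norm_nonneg _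
  have hsplit : regularized tikhonov T α z - x =
      regularized tikhonov T α (z - T x) - (x - regularized tikhonov T α (T x)) := by
    rw [regularized_sub]
    abel
  rw [hsplit, map_sub]
  calc _ ≤ ‖cfc (fun t : ℝ => t ^ γ) (normalOp T) (regularized tikhonov T α (z - T x))‖ +
          ‖cfc (fun t : ℝ => t ^ γ) (normalOp T) (x - regularized tikhonov T α (T x))‖ :=
        norm_sub_le _ _
    _ ≤ 4 * √(1 + c) * α ^ (γ - s) *
          (psiMod (fun t : ℝ => t ^ s) tikhonov T α z + α ^ (μ + s) * ‖v‖) +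
            α ^ (μ + γ) * ‖v‖ := by
        refine add_le_add ((hz.norm_cfc_regularized_le hs hsγ hc hα0).trans ?_)
          (norm_cfc_rpow_sub_regularized_le hα0 hμ (hs.trans hsγ) hμγ hx)
        gcongr
        exact (psiMod_sub_le _ _ T α _ z).trans
          (add_le_add_right (psiMod_rpow_apply_le hα0 hμ hs (by linarith) hx) _)
    _ = 4 * √(1 + c) * α ^ (γ - s) * psiMod (fun t : ℝ => t ^ s) tikhonov T α z +
          (4 * √(1 + c) + 1) * (α ^ (μ + γ) * ‖v‖) := by
        have hexp : α ^ (μ + γ) = α ^ (γ - s) * α ^ (μ + s) := by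
          rw [← Real.rpow_add hα0]
          ring_nf
        rw [hexp]
        ring
    _ ≤ _ := by
        gcongr
        exact hα.2

lemma exists_norm_cfc_rpow_argmin_sub_le (hμ : 0 < μ) (hs : 0 ≤ s) (hsγ : s ≤ γ)
    (hγ : γ ≤ 1 / 2) (hμγ : μ + γ ≤ 1) (hc : 0 ≤ c)
    (hx : x = cfc (fun t : ℝ => t ^ μ) (normalOp T) v) :
    ∃ C, ∀ δ ∈ Ioc (0 : ℝ) 1, ∀ z, ‖z - T x‖ ≤ δ →
      NoiseCondition (fun t : ℝ => t ^ γ) T c (z - T x) → ∀ α,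
        IsArgmin (fun β => psiMod (fun t : ℝ => t ^ s) tikhonov T β z) αmax α →
          ‖cfc (fun t : ℝ => t ^ γ) (normalOp T) (regularized tikhonov T α z - x)‖ ≤
            C * δ ^ (psiRate μ s * (μ + γ)) := by
  have hs' : s ∈ Icc (0 : ℝ) (1 / 2) := ⟨hs, hsγ.trans hγ⟩
  have hμs : μ + s ≤ 1 := by linarith
  obtain ⟨u, K, hxu, hK⟩ :=
    exists_source_argmin_rpow_le (αmax := αmax) hμ hs' hμs (hs.trans hsγ) hx
  set P := αmax ^ (μ + s) * ‖u‖ + αmax ^ (s - 1 / 2)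
  refine ⟨4 * √(1 + c) * αmax ^ (γ - s) * P + (4 * √(1 + c) + 1) * K,
    fun δ hδ z hz hnoise α hα => ?_⟩
  have hψ := psiMod_argmin_le hμ.le hs' hμs hxu hδ hz hα
  have hαmax : 0 ≤ αmax := hα.1.1.le.trans hα.1.2
  have hP : 0 ≤ P := by positivity
  have hδ_le : δ ^ psiRate μ s ≤ δ ^ (psiRate μ s * (μ + γ)) :=
    Real.rpow_le_rpow_of_exponent_ge hδ.1 hδ.2
      (mul_le_of_le_one_right (psiRate_nonneg hμ.le hs) hμγ)
  calc _ ≤ 4 * √(1 + c) * αmax ^ (γ - s) * psiMod (fun t : ℝ => t ^ s) tikhonov T α z +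
          (4 * √(1 + c) + 1) * (α ^ (μ + γ) * ‖u‖) :=
        norm_cfc_rpow_error_le hμ.le hs hsγ hμγ hc hxu hα.1 hnoise
    _ ≤ 4 * √(1 + c) * αmax ^ (γ - s) * (P * δ ^ (psiRate μ s * (μ + γ))) +
          (4 * √(1 + c) + 1) * (K * δ ^ (psiRate μ s * (μ + γ))) := by
        have hKα := hK δ hδ z hz α hα
        have hPψ := hψ.trans (mul_le_mul_of_nonneg_left hδ_le hP)
        gcongr
    _ = _ := by ring

theorem exists_norm_argmin_psi_sub_le (hμ : 0 < μ) (hμ1 : μ ≤ 1) (hγ : 0 ≤ γ) (hc : 0 ≤ c)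
    (hx : x = cfc (fun t : ℝ => t ^ μ) (normalOp T) v) :
    ∃ C, ∀ δ ∈ Ioc (0 : ℝ) 1, ∀ z, ‖z - T x‖ ≤ δ →
      NoiseCondition (fun t : ℝ => t ^ γ) T c (z - T x) → ∀ α,
        IsArgmin (fun β => psi tikhonov T β z) αmax α →
          ‖regularized tikhonov T α z - x‖ ≤ C * δ ^ (psiRate μ 0 * μ) := by
  obtain ⟨C, hC⟩ := exists_norm_cfc_rpow_argmin_sub_le (αmax := αmax) hμ le_rfl le_rfl
    (by norm_num) (by rwa [add_zero]) hc hx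
  simp only [← psi_eq_psiMod, cfc_rpow_zero, add_zero] at hC
  exact ⟨C, fun δ hδ z hz hnoise => hC δ hδ z hz (hnoise.rpow_of_le le_rfl hγ hc)⟩

theorem exists_norm_inner_argmin_psiMod_sub_le (hμ : 0 < μ) (hs : 0 ≤ s) (hsγ : s ≤ γ)
    (hγ : γ ≤ 1 / 2) (hμγ : μ + γ ≤ 1) (hc : 0 ≤ c)
    (hx : x = cfc (fun t : ℝ => t ^ μ) (normalOp T) v) (u : X) :
    ∃ C, ∀ δ ∈ Ioc (0 : ℝ) 1, ∀ z, ‖z - T x‖ ≤ δ →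
      NoiseCondition (fun t : ℝ => t ^ γ) T c (z - T x) → ∀ α,
        IsArgmin (fun β => psiMod (fun t : ℝ => t ^ s) tikhonov T β z) αmax α →
          ‖inner 𝕜 (cfc (fun t : ℝ => t ^ γ) (normalOp T) u) (regularized tikhonov T α z - x)‖ ≤
            C * δ ^ (psiRate μ s * (μ + γ)) := by
  obtain ⟨C, hC⟩ := exists_norm_cfc_rpow_argmin_sub_le (αmax := αmax) hμ hs hsγ hγ hμγ hc hx
  refine ⟨‖u‖ * C, fun δ hδ z hz hnoise α hα => ?_⟩
  rw [mul_assoc]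
  exact (norm_inner_cfc_apply_le _ _ u _).trans
    (mul_le_mul_of_nonneg_left (hC δ hδ z hz hnoise α hα) (norm_nonneg u))

end Rates

end LinearFunctionalStrategy

open LinearFunctionalStrategy in
theorem corollary2p1_general {𝕜 X Y : Type*} [RCLike 𝕜]
    [NormedAddCommGroup X] [InnerProductSpace 𝕜 X] [CompleteSpace X]
    [NormedAddCommGroup Y] [InnerProductSpace 𝕜 Y] [CompleteSpace Y]
    (T : X →L[𝕜] Y) (μ γ : ℝ) (hμ : 0 < μ) (hγ : γ ∈ Set.Icc (0 : ℝ) (1 / 2)) (hμγ : μ + γ ≤ 1)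
    (x f : X)
    (hx : ∃ v : X, x = cfc (fun t : ℝ => t ^ μ) (normalOp T) v)
    (hf : ∃ v : X, f = cfc (fun t : ℝ => t ^ γ) (normalOp T) v)
    (yδ : ℝ → Y) (δ₀ : ℝ) (hδ₀ : 0 < δ₀)
    (hyδ : ∀ δ ∈ Set.Ioo 0 δ₀, ‖yδ δ - T x‖ ≤ δ)
    (c : ℝ)
    (hnoise : ∀ δ ∈ Set.Ioo 0 δ₀, NoiseCondition (fun t : ℝ => t ^ γ) T c (yδ δ - T x))
    (αmax : ℝ) :
    (∃ C δ₁ : ℝ, 0 < δ₁ ∧ ∀ δ ∈ Set.Ioo 0 δ₁, ∀ α : ℝ,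
      IsArgmin (fun β => psi tikhonov T β (yδ δ)) αmax α →
        ‖regularized tikhonov T α (yδ δ) - x‖ ≤ C * δ ^ (2 * μ / (2 * μ + 1) * μ)) ∧
    (∃ C δ₁ : ℝ, 0 < δ₁ ∧ ∀ δ ∈ Set.Ioo 0 δ₁, ∀ α : ℝ,
      IsArgmin (fun β => psi tikhonov T β (yδ δ)) αmax α →
        ‖inner 𝕜 f (regularized tikhonov T α (yδ δ) - x)‖ ≤
          C * δ ^ (2 * μ / (2 * μ + 1) * (μ + γ))) ∧
    (∃ C δ₁ : ℝ, 0 < δ₁ ∧ ∀ δ ∈ Set.Ioo 0 δ₁, ∀ α : ℝ,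
      IsArgmin (fun β => psiMod (fun t : ℝ => t ^ γ) tikhonov T β (yδ δ)) αmax α →
        ‖inner 𝕜 f (regularized tikhonov T α (yδ δ) - x)‖ ≤
          C * δ ^ (2 * (μ + γ) ^ 2 / (2 * μ + 1))) := by
  obtain ⟨v, hx⟩ := hx
  obtain ⟨u, rfl⟩ := hf
  have hδ₁ : 0 < min δ₀ 1 := lt_min hδ₀ one_pos
  have hdata : ∀ δ ∈ Set.Ioo 0 (min δ₀ 1), δ ∈ Set.Ioc 0 1 ∧ ‖yδ δ - T x‖ ≤ δ ∧
      NoiseCondition (fun t : ℝ => t ^ γ) T |c| (yδ δ - T x) := fun δ hδ =>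
    have hδ' : δ ∈ Set.Ioo 0 δ₀ := ⟨hδ.1, hδ.2.trans_le (min_le_left _ _)⟩
    ⟨⟨hδ.1, hδ.2.le.trans (min_le_right _ _)⟩, hyδ δ hδ', (hnoise δ hδ').mono (le_abs_self c)⟩
  refine ⟨?_, ?_, ?_⟩
  · obtain ⟨C, hC⟩ := exists_norm_argmin_psi_sub_le (αmax := αmax) hμ (by linarith [hγ.1]) hγ.1
      (abs_nonneg c) hx
    refine ⟨C, _, hδ₁, fun δ hδ α hα => ?_⟩
    obtain ⟨hδ01, hle, hw⟩ := hdata δ hδ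
    simpa only [psiRate, add_zero] using hC δ hδ01 _ hle hw α hα
  · obtain ⟨C, hC⟩ := exists_norm_inner_argmin_psiMod_sub_le (αmax := αmax) hμ le_rfl hγ.1 hγ.2
      hμγ (abs_nonneg c) hx u
    refine ⟨C, _, hδ₁, fun δ hδ α hα => ?_⟩
    obtain ⟨hδ01, hle, hw⟩ := hdata δ hδ
    simp only [psi_eq_psiMod] at hα
    simpa only [psiRate, add_zero] using hC δ hδ01 _ hle hw α hα
  · obtain ⟨C, hC⟩ := exists_norm_inner_argmin_psiMod_sub_le (αmax := αmax) hμ hγ.1 le_rfl hγ.2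
      hμγ (abs_nonneg c) hx u
    have hexp : 2 * (μ + γ) ^ 2 / (2 * μ + 1) = psiRate μ γ * (μ + γ) := by
      rw [psiRate]
      ring
    refine ⟨C, _, hδ₁, fun δ hδ α hα => ?_⟩
    obtain ⟨hδ01, hle, hw⟩ := hdata δ hδ
    exact hexp ▸ hC δ hδ01 _ hle hw α hα

open LinearFunctionalStrategy in
theorem corollary2p1 {𝕜 X Y : Type*} [RCLike 𝕜]
    [NormedAddCommGroup X] [InnerProductSpace 𝕜 X] [CompleteSpace X]
    [NormedAddCommGroup Y] [InnerProductSpace 𝕜 Y] [CompleteSpace Y]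
    (T : X →L[𝕜] Y) (hT : Function.Injective T)
    (hT' : Function.Injective (ContinuousLinearMap.adjoint T))
    (μ γ : ℝ) (hμ : 0 < μ) (hγ : γ ∈ Set.Icc (0 : ℝ) (1 / 2)) (hμγ : μ + γ ≤ 1)
    (x f : X) (y : Y) (hxy : T x = y) (hy : y ≠ 0)
    (hx : ∃ v : X, x = cfc (fun t : ℝ => t ^ μ) (normalOp T) v)
    (hf : ∃ v : X, f = cfc (fun t : ℝ => t ^ γ) (normalOp T) v)
    (yδ : ℝ → Y) (δ₀ : ℝ) (hδ₀ : 0 < δ₀)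
    (hyδ : ∀ δ ∈ Set.Ioo 0 δ₀, ‖yδ δ - y‖ ≤ δ)
    (c : ℝ)
    (hnoise : ∀ δ ∈ Set.Ioo 0 δ₀, NoiseCondition (fun t : ℝ => t ^ γ) T c (yδ δ - y))
    (αmax : ℝ) (hαmax : 0 < αmax) :
    (∃ C δ₁ : ℝ, 0 < δ₁ ∧ ∀ δ ∈ Set.Ioo 0 δ₁, ∀ α : ℝ,
      IsArgmin (fun β => psi tikhonov T β (yδ δ)) αmax α →
        ‖regularized tikhonov T α (yδ δ) - x‖ ≤ C * δ ^ (2 * μ / (2 * μ + 1) * μ)) ∧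
    (∃ C δ₁ : ℝ, 0 < δ₁ ∧ ∀ δ ∈ Set.Ioo 0 δ₁, ∀ α : ℝ,
      IsArgmin (fun β => psi tikhonov T β (yδ δ)) αmax α →
        ‖inner 𝕜 f (regularized tikhonov T α (yδ δ) - x)‖ ≤
          C * δ ^ (2 * μ / (2 * μ + 1) * (μ + γ))) ∧
    (∃ C δ₁ : ℝ, 0 < δ₁ ∧ ∀ δ ∈ Set.Ioo 0 δ₁, ∀ α : ℝ,
      IsArgmin (fun β => psiMod (fun t : ℝ => t ^ γ) tikhonov T β (yδ δ)) αmax α →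
        ‖inner 𝕜 f (regularized tikhonov T α (yδ δ) - x)‖ ≤
          C * δ ^ (2 * (μ + γ) ^ 2 / (2 * μ + 1))) := by
  subst hxy
  exact corollary2p1_general T μ γ hμ hγ hμγ x f hx hf yδ δ₀ hδ₀ hyδ c hnoise αmax
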